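/- Let $d\ge 1$ and $L\ge 1$ be integers and let $\Lambda=\{-L+1,-L+2,\ldots,L\}^d\subset\mathbb Z^d$. For $x\in\Lambda$ and $m=1,\ldots,d$ let $x+e_m$ be the neighbour of $x$ in the $m$-th direction with periodic boundary conditions (so the $m$-th coordinate $L$ is followed by $-L+1$). On the fermionic Fock space of dimension $2^{2|\Lambda|}$ let $a_{x,\sigma}$, $x\in\Lambda$, $\sigma\in\{\uparrow,\downarrow\}$, be the fermion annihilation operators, $\{a_{x,\sigma},a^\dagger_{x',\sigma'}\}=\delta_{x,x'}\delta_{\sigma,\sigma'}$, $\{a_{x,\sigma},a_{x',\sigma'}\}=0$. Put $$\Gamma_x^{(+)}=a_{x,\uparrow}^\dagger a_{x,\downarrow}^\dagger,\quad \Gamma_x^{(-)}=a_{x,\downarrow}a_{x,\uparrow},\quad \Gamma_x^{(1)}=\Gamma_x^{(+)}+\Gamma_x^{(-)},\quad \Gamma_x^{(2)}=i[\Gamma_x^{(+)}-\Gamma_x^{(-)}].$$ For $\kappa\in\mathbb R$, $g>0$, $B\in\mathbb R$ and real-valued functions $h=(h_1,\ldots,h_d)$ on $\Lambda$, let $$H^{(\Lambda)}(B,h)=H_{\rm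 hop}^{(\Lambda)}+H_{\rm int}^{(\Lambda)}(h)-B\,O^{(\Lambda)},\qquad O^{(\Lambda)}=\sum_{x\in\Lambda}(-1)^{x^{(1)}+\cdots+x^{(d)}}\Gamma_x^{(2)},$$ where $$H_{\rm hop}^{(\Lambda)}=i\kappa\sum_{i=1}^d\sum_{\sigma=\uparrow,\downarrow}\sum_{x\in\Lambda}s_i(x)\,(-1)^{x^{(1)}+\cdots+x^{(i-1)}}\left[a_{x,\sigma}^\dagger a_{x+e_i,\sigma}-a_{x+e_i,\sigma}^\dagger a_{x,\sigma}\right],$$ with $s_i(x)=-1$ if $x^{(i)}=L$ and $s_i(x)=1$ otherwise (anti-periodic boundary conditions for the hopping), and $$H_{\rm int}^{(\Lambda)}(h)=\frac g4\sum_{x\in\Lambda}\sum_{m=1}^d\left[\Gamma_x^{(1)}+\Gamma_{x+e_m}^{(1)}+(-1)^{x^{(1)}+\cdots+x^{(d)}}h_m(x)\right]^2-\frac g4\sum_{x\in\Lambda}\sum_{m=1}^d\left[\Gamma_x^{(2)}-\Gamma_{x+e_m}^{(2)}\right]^2-\frac{dg}2\sum_{x\in\Lambda}\left\{[\Gamma_x^{(1)}]^2-[\Gamma_x^{(2)}]^2\right\}.$$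 Then, for every $\beta\ge 0$ and all real-valued functions $h=(h_1,\ldots,h_d)$ on $\Lambda$, $$\operatorname{Tr}\exp[-\beta H^{(\Lambda)}(B,h)]\le \operatorname{Tr}\exp[-\beta H^{(\Lambda)}(B,0)].$$ -/

import Mathlib

open scoped ComplexOrder Matrix

namespace BCSLattice

noncomputable section

/-! ## Fermionic Fock space over a finite set of modes -/

/-- Operators on the fermionic Fock space over the modes `ι`, as matrices in the occupation-number
basis: a basis vector is the finite set of occupied modes. -/
abbrev FockOp (ι : Type*) : Type _ := Matrix (Finset ι) (Finset ι) ℂ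

/-- The annihilation operator `a_i`, for the enumeration `e` of the modes: it maps the basis vector
`|S⟩` to `(-1) ^ #{j ∈ S : j precedes i} |S \ {i}⟩` if `i ∈ S`, and to `0` otherwise. The entry
`(T, S)` is `⟨T| a_i |S⟩`. -/
def annihilate {ι : Type*} [DecidableEq ι] {n : ℕ} (e : ι ≃ Fin n) (i : ι) : FockOp ι :=
  Matrix.of fun T S => if i ∈ S ∧ T = S.erase i then (-1) ^ {j ∈ S | e j < e i}.card else 0

/-! ## The lattice -/

/-- The coordinates `-L+1, …, L`. -/
abbrev Coord (L : ℕ) : Type := ↥(Finset.Icc (1 - (L : ℤ)) (L : ℤ))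

/-- The lattice `Λ = {-L+1, …, L}^d`. -/
abbrev Site (d L : ℕ) : Type := Fin d → Coord L

/-- The periodic successor of a coordinate: `L` is followed by `-L+1`. -/
def Coord.next {L : ℕ} (c : Coord L) : Coord L :=
  if h : (c : ℤ) = L then
    ⟨1 - (L : ℤ), by have := Finset.mem_Icc.1 c.2; exact Finset.mem_Icc.2 ⟨le_rfl, by omega⟩⟩
  else
    ⟨(c : ℤ) + 1, by have := Finset.mem_Icc.1 c.2; exact Finset.mem_Icc.2 ⟨by omega, by omega⟩⟩

/-- The site `x + e_m`, with periodic boundary conditions. -/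
def shift {d L : ℕ} (m : Fin d) (x : Site d L) : Site d L :=
  Function.update x m (Coord.next (x m))

/-- `(-1)^(x^(1) + ⋯ + x^(d))`. -/
def parity {d L : ℕ} (x : Site d L) : ℂ := (-1) ^ (∑ j, (x j : ℤ))

/-- `(-1)^(x^(1) + ⋯ + x^(i-1))`, the sign of the hopping amplitude in the `i`-th direction. -/
def hopSign {d L : ℕ} (i : Fin d) (x : Site d L) : ℂ := (-1) ^ (∑ j with j < i, (x j : ℤ))

/-- The modes `(x, σ)`; spin up is `σ = 0` and spin down is `σ = 1`. -/
abbrev Mode (d L : ℕ) : Type := Site d L × Fin 2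

/-- Operators on the Fock space of spin-1/2 fermions on `Λ`. -/
abbrev Op (d L : ℕ) : Type := FockOp (Mode d L)

/-- The fermion operator `a_{x,σ}`, for a fixed enumeration of the modes. -/
def a {d L : ℕ} (x : Site d L) (σ : Fin 2) : Op d L :=
  annihilate (Fintype.equivFin (Mode d L)) (x, σ)

/-! ## The Hamiltonian -/

/-- `a_{x,σ}† a_{y,σ} - a_{y,σ}† a_{x,σ}`, summed over the spin. -/
def hopBond {d L : ℕ} (x y : Site d L) : Op d L :=
  ∑ σ : Fin 2, ((a x σ)ᴴ * a y σ - (a y σ)ᴴ * a x σ)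

/-- The hopping Hamiltonian in the `i`-th direction. The bonds that leave a site with `x^(i) = L`
are the boundary bonds, from `x_i^+` to `x_i^-`, which have the opposite sign. -/
def hopDir (d L : ℕ) (κ : ℝ) (i : Fin d) : Op d L :=
  (Complex.I * κ) • (∑ x : Site d L with (x i : ℤ) ≠ L, hopSign i x • hopBond x (shift i x))
    - (Complex.I * κ) • (∑ x : Site d L with (x i : ℤ) = L, hopSign i x • hopBond x (shift i x))

/-- The hopping Hamiltonian `H_hop`. -/
def hop (d L : ℕ) (κ : ℝ) : Op d L := ∑ i, hopDir d L κ i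

/-- `Γ_x^(+) = a_{x,↑}† a_{x,↓}†`. -/
def ΓPlus {d L : ℕ} (x : Site d L) : Op d L := (a x 0)ᴴ * (a x 1)ᴴ

/-- `Γ_x^(-) = a_{x,↓} a_{x,↑}`. -/
def ΓMinus {d L : ℕ} (x : Site d L) : Op d L := a x 1 * a x 0

/-- `Γ_x^(1)`. -/
def Γ₁ {d L : ℕ} (x : Site d L) : Op d L := ΓPlus x + ΓMinus x

/-- `Γ_x^(2)`. -/
def Γ₂ {d L : ℕ} (x : Site d L) : Op d L := Complex.I • (ΓPlus x - ΓMinus x)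

/-- The order parameter `O`. -/
def orderParameter (d L : ℕ) : Op d L := ∑ x : Site d L, parity x • Γ₂ x

/-- The interaction Hamiltonian `H_int(h)`. -/
def interaction (d L : ℕ) (g : ℝ) (h : Fin d → Site d L → ℝ) : Op d L :=
  ((g / 4 : ℝ) : ℂ) • (∑ x : Site d L, ∑ m : Fin d,
      (Γ₁ x + Γ₁ (shift m x) + (parity x * (h m x : ℂ)) • (1 : Op d L)) ^ 2)
    - ((g / 4 : ℝ) : ℂ) • (∑ x : Site d L, ∑ m : Fin d, (Γ₂ x - Γ₂ (shift m x)) ^ 2)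
    - ((d * g / 2 : ℝ) : ℂ) • (∑ x : Site d L, (Γ₁ x ^ 2 - Γ₂ x ^ 2))

/-- The Hamiltonian `H(B, h)`. -/
def hamiltonian (d L : ℕ) (κ g B : ℝ) (h : Fin d → Site d L → ℝ) : Op d L :=
  hop d L κ + interaction d L g h - (B : ℂ) • orderParameter d L

end

end BCSLattice

/-!
The inequality is Gaussian domination, proved by reflection positivity. Write `k b` for the number
`(-1)^(x₁ + ⋯ + x_d) h_m(x)` on the bond `b = (x, m)`, and `Z(k)` for the trace of the exponential.

Cut the periodic lattice by a plane through the bonds between `c` and `c + 1` in some direction,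
and by the opposite plane. The fermions on the two halves anticommute, but every representation of
the anticommutation relations on a space of the right dimension is unitarily equivalent to Fock
space (`IsCAR.exists_starAlgHom`), so one may represent the operators on the doubled Fock space of
the left half in a convenient way: as `i a P ⊗ 1` on the left and, after a particle-hole
transformation with signs, as `± P ⊗ a†` on the right, where `P` is the fermion parity
(`doubledOp`). The factor `i` does not affect the operators within the left half, but it cancels
the `i` of the hopping amplitude on the bonds that cross the planes. In this representation
`Γ⁽¹⁾` becomes `-1 ⊗ Γ⁽¹⁾` and `Γ⁽²⁾` becomes `1 ⊗ Γ⁽²⁾ = -1 ⊗ conj Γ⁽²⁾` on the right. With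
`k = u - v` on the crossing bonds, and `u` and the reflected `v` on the two halves, minus the
Hamiltonian takes the form `A(u) ⊗ 1 + 1 ⊗ conj A(v) + ∑ D(u) ⊗ conj D(v)` (`energy_doubledOp`);
the shift in `Γ⁽¹⁾_x + Γ⁽¹⁾_y + k` is shared between the two factors of
`(Γ⁽¹⁾ + u) ⊗ 1 - 1 ⊗ (Γ⁽¹⁾ + v)`.

The trace of a product of operators `D ⊗ conj E` is `tr D` times the conjugate of `tr E`, so the
Cauchy-Schwarz inequality for the powers of `1 + X / N + O(1 / N²)` gives
`Z(u, v)² ≤ Z(u, u) Z(v, v)` (`norm_trace_exp_sq_le`). On the right-hand side the crossing bonds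
carry `0`. Every bond is crossed by some such plane (`latticeReflection`), and reflections keep the
values of `k` in a finite set that is symmetric and contains `0`; a maximizer of `Z` in this set
with the fewest nonzero values must therefore vanish (`le_apply_zero_of_reflections`).

The amplitudes of the hopping term fit this scheme for every position of the planes because the
sign change at the boundary can be moved by a gauge transformation (`windSign`), and because the
signs `(-1)^(x₁ + ⋯ + x_{i-1})` change under the reflection in direction `m` exactly for `i > m`,
while the signs `(-1)^(x₁ + ⋯ + x_{m-1})` of the particle-hole transformation alternate exactly
along the directions `i < m`.
-/

namespace BCSLattice

noncomputable section

section

open Filter Topology Kronecker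

/-! ### The exponential as a limit of powers -/

theorem norm_pow_sub_pow_le_of_norm_le {𝔸 : Type*} [NormedRing 𝔸] [NormOneClass 𝔸] {a b : 𝔸}
    {M : ℝ} (hM : 1 ≤ M) (ha : ‖a‖ ≤ M) (hb : ‖b‖ ≤ M) (n : ℕ) :
    ‖a ^ n - b ^ n‖ ≤ n * M ^ n * ‖a - b‖ := by
  induction n with
  | zero => simp
  | succ n ih =>
    have hM0 : 0 ≤ M := by linarith
    have e : a ^ (n + 1) - b ^ (n + 1) = a ^ n * (a - b) + (a ^ n - b ^ n) * b := by
      rw [pow_succ, pow_succ]; noncomm_ring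
    have h1 : ‖a ^ n * (a - b)‖ ≤ M ^ n * ‖a - b‖ :=
      (norm_mul_le _ _).trans (mul_le_mul_of_nonneg_right
        ((norm_pow_le a n).trans (pow_le_pow_left₀ (norm_nonneg _) ha n)) (norm_nonneg _))
    have h2 : ‖(a ^ n - b ^ n) * b‖ ≤ n * M ^ n * ‖a - b‖ * M :=
      (norm_mul_le _ _).trans (mul_le_mul ih hb (norm_nonneg _) (by positivity))
    have h3 : M ^ n * ‖a - b‖ ≤ M ^ (n + 1) * ‖a - b‖ :=
      mul_le_mul_of_nonneg_right (pow_le_pow_right₀ hM n.le_succ) (norm_nonneg _)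
    rw [e]
    refine (norm_add_le _ _).trans ?_
    push_cast
    calc _ ≤ M ^ (n + 1) * ‖a - b‖ + n * M ^ n * ‖a - b‖ * M := add_le_add (h1.trans h3) h2
      _ = _ := by ring

theorem tendsto_smul_exp_div_sub_one {𝔸 : Type*} [NormedRing 𝔸] [NormedAlgebra ℂ 𝔸]
    [CompleteSpace 𝔸] (X : 𝔸) :
    Tendsto (fun N : ℕ => (N : ℂ) • (NormedSpace.exp ((N : ℂ)⁻¹ • X) - 1)) atTop (𝓝 X) := by
  have h := hasDerivAt_exp_smul_const (𝕂 := ℂ) X (0 : ℂ)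
  have h2 := h.tendsto_slope_zero
  simp only [zero_add, zero_smul, NormedSpace.exp_zero, one_mul] at h2
  have h3 : Tendsto (fun N : ℕ => ((N : ℂ))⁻¹) atTop (𝓝[≠] 0) := by
    rw [tendsto_nhdsWithin_iff]
    refine ⟨tendsto_inv_atTop_nhds_zero_nat, ?_⟩
    filter_upwards [eventually_gt_atTop 0] with N hN
    simpa using hN.ne'
  simpa [Function.comp_def] using h2.comp h3

/-- If `T N = 1 + X / N + o(1 / N)` then `T N ^ N` tends to `exp X`. -/
theorem tendsto_pow_exp {𝔸 : Type*} [NormedRing 𝔸] [NormOneClass 𝔸] [NormedAlgebra ℂ 𝔸]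
    [CompleteSpace 𝔸] {X : 𝔸} {T : ℕ → 𝔸}
    (hT : Tendsto (fun N : ℕ => (N : ℂ) • (T N - 1)) atTop (𝓝 X)) :
    Tendsto (fun N => T N ^ N) atTop (𝓝 (NormedSpace.exp X)) := by
  have hS := tendsto_smul_exp_div_sub_one X
  set S : ℕ → 𝔸 := fun N => NormedSpace.exp ((N : ℂ)⁻¹ • X) with hSdef
  have key : ∀ U : ℕ → 𝔸, Tendsto (fun N : ℕ => (N : ℂ) • (U N - 1)) atTop (𝓝 X) →
      ∀ᶠ N : ℕ in atTop, ‖U N‖ ≤ Real.exp ((‖X‖ + 1) / N) := by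
    intro U hU
    have h1 := hU.norm.eventually (gt_mem_nhds (lt_add_one ‖X‖))
    filter_upwards [h1, eventually_gt_atTop 0] with N h hN
    have hN' : (0 : ℝ) < N := by exact_mod_cast hN
    rw [norm_smul, Complex.norm_natCast] at h
    have h2 : ‖U N - 1‖ ≤ (‖X‖ + 1) / N := by
      rw [le_div_iff₀ hN']; linarith
    have h3 : ‖U N‖ ≤ 1 + ‖U N - 1‖ := by
      have := norm_add_le (1 : 𝔸) (U N - 1)
      simpa using this
    linarith [Real.add_one_le_exp ((‖X‖ + 1) / N)]
  have hdiff : Tendsto (fun N : ℕ => Real.exp (‖X‖ + 1) *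
      ‖(N : ℂ) • (T N - 1) - (N : ℂ) • (S N - 1)‖) atTop (𝓝 0) := by
    have := (hT.sub hS).norm.const_mul (Real.exp (‖X‖ + 1))
    simpa using this
  have hTS : Tendsto (fun N => T N ^ N - S N ^ N) atTop (𝓝 0) := by
    refine squeeze_zero_norm' ?_ hdiff
    filter_upwards [key T hT, key S hS, eventually_gt_atTop 0] with N h1 h2 hN
    have hN' : (N : ℝ) ≠ 0 := by exact_mod_cast hN.ne'
    have h3 := norm_pow_sub_pow_le_of_norm_le (Real.one_le_exp (by positivity)) h1 h2 N
    rw [← Real.exp_nat_mul, mul_div_cancel₀ _ hN'] at h3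
    refine h3.trans (le_of_eq ?_)
    rw [← smul_sub, norm_smul, Complex.norm_natCast, sub_sub_sub_cancel_right]
    ring
  have hSN : ∀ᶠ N : ℕ in atTop, S N ^ N = NormedSpace.exp X := by
    filter_upwards [eventually_gt_atTop 0] with N hN
    have hN' : (N : ℂ) ≠ 0 := by exact_mod_cast hN.ne'
    let := NormedAlgebra.restrictScalars ℚ ℂ 𝔸
    rw [hSdef, ← NormedSpace.exp_nsmul, ← Nat.cast_smul_eq_nsmul ℂ, smul_smul,
      mul_inv_cancel₀ hN', one_smul]
  have := hTS.add (tendsto_const_nhds (x := NormedSpace.exp X))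
  rw [zero_add] at this
  refine this.congr' ?_
  filter_upwards [hSN] with N hN
  rw [hN]; abel

/-! ### Left and right factors of a doubled system -/

variable {n : Type*} [Fintype n] [DecidableEq n]

/-- The entrywise complex conjugate of a matrix. -/
def conjM : Matrix n n ℂ →+* Matrix n n ℂ := (starRingEnd ℂ).mapMatrix

theorem conjM_smul (z : ℂ) (A : Matrix n n ℂ) : conjM (z • A) = star z • conjM A := by
  ext i j; simp [conjM]

theorem conjM_conjTranspose (A : Matrix n n ℂ) : conjM Aᴴ = (conjM A)ᴴ := by
  ext i j; simp [conjM]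

theorem trace_conjM (A : Matrix n n ℂ) : (conjM A).trace = star A.trace := by
  simp [conjM, Matrix.trace]

/-- The operator `A ⊗ 1` on the left half of the doubled system. -/
def inl : Matrix n n ℂ →⋆ₐ[ℂ] Matrix (n × n) (n × n) ℂ where
  toFun A := A ⊗ₖ 1
  map_one' := Matrix.one_kronecker_one
  map_mul' A B := by rw [← Matrix.mul_kronecker_mul, mul_one]
  map_zero' := Matrix.zero_kronecker _
  map_add' A B := Matrix.add_kronecker _ _ _
  commutes' z := by
    rw [Algebra.algebraMap_eq_smul_one, Matrix.smul_kronecker, Matrix.one_kronecker_one,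
      Algebra.algebraMap_eq_smul_one]
  map_star' A := by
    simp [Matrix.star_eq_conjTranspose, Matrix.conjTranspose_kronecker]

/-- The operator `1 ⊗ A` on the right half of the doubled system. -/
def inr : Matrix n n ℂ →⋆ₐ[ℂ] Matrix (n × n) (n × n) ℂ where
  toFun A := 1 ⊗ₖ A
  map_one' := Matrix.one_kronecker_one
  map_mul' A B := by rw [← Matrix.mul_kronecker_mul, mul_one]
  map_zero' := Matrix.kronecker_zero _
  map_add' A B := Matrix.kronecker_add _ _ _
  commutes' z := by
    rw [Algebra.algebraMap_eq_smul_one, Matrix.kronecker_smul, Matrix.one_kronecker_one,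
      Algebra.algebraMap_eq_smul_one]
  map_star' A := by
    simp [Matrix.star_eq_conjTranspose, Matrix.conjTranspose_kronecker]

theorem inl_conjTranspose (A : Matrix n n ℂ) : (inl A)ᴴ = inl Aᴴ := (map_star inl A).symm

theorem inr_conjTranspose (A : Matrix n n ℂ) : (inr A)ᴴ = inr Aᴴ := (map_star inr A).symm

theorem inl_mul_inr (A B : Matrix n n ℂ) : inl A * inr B = A ⊗ₖ B := by
  change (A ⊗ₖ 1) * (1 ⊗ₖ B) = _
  rw [← Matrix.mul_kronecker_mul, mul_one, one_mul]

theorem inr_mul_inl (A B : Matrix n n ℂ) : inr B * inl A = inl A * inr B := by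
  rw [inl_mul_inr]
  change (1 ⊗ₖ B) * (A ⊗ₖ 1) = _
  rw [← Matrix.mul_kronecker_mul, mul_one, one_mul]

theorem trace_inl_mul_inr (A B : Matrix n n ℂ) :
    (inl A * inr B).trace = A.trace * B.trace := by
  rw [inl_mul_inr, Matrix.trace_kronecker]

/-! ### Reflection positivity and the Schwarz inequality -/

/-- `SchwarzTriple X Y Z` says that, for some families `D` and `E` of operators on one half of
the system, `X = ∑ D ⊗ D̄`, `Y = ∑ D ⊗ Ē` and `Z = ∑ E ⊗ Ē`, the bar being entrywise complex
conjugation. -/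
def SchwarzTriple (X Y Z : Matrix (n × n) (n × n) ℂ) : Prop :=
  ∃ (ι : Type) (_ : Fintype ι) (D E : ι → Matrix n n ℂ),
    X = ∑ i, inl (D i) * inr (conjM (D i)) ∧ Y = ∑ i, inl (D i) * inr (conjM (E i)) ∧
      Z = ∑ i, inl (E i) * inr (conjM (E i))

namespace SchwarzTriple

variable {X Y Z X' Y' Z' : Matrix (n × n) (n × n) ℂ}

theorem of_pair (D E : Matrix n n ℂ) : SchwarzTriple (inl D * inr (conjM D))
    (inl D * inr (conjM E)) (inl E * inr (conjM E)) :=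
  ⟨Unit, inferInstance, fun _ => D, fun _ => E, by simp, by simp, by simp⟩

theorem zero : SchwarzTriple (0 : Matrix (n × n) (n × n) ℂ) 0 0 :=
  ⟨Empty, inferInstance, fun _ => 0, fun _ => 0, by simp, by simp, by simp⟩

theorem one : SchwarzTriple (1 : Matrix (n × n) (n × n) ℂ) 1 1 := by
  simpa using of_pair (1 : Matrix n n ℂ) 1

theorem add (h : SchwarzTriple X Y Z) (h' : SchwarzTriple X' Y' Z') :
    SchwarzTriple (X + X') (Y + Y') (Z + Z') := by
  obtain ⟨ι, _, D, E, rfl, rfl, rfl⟩ := h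
  obtain ⟨ι', _, D', E', rfl, rfl, rfl⟩ := h'
  exact ⟨ι ⊕ ι', inferInstance, Sum.elim D D', Sum.elim E E', by simp, by simp, by simp⟩

theorem smul (h : SchwarzTriple X Y Z) {r : ℝ} (hr : 0 ≤ r) :
    SchwarzTriple ((r : ℂ) • X) ((r : ℂ) • Y) ((r : ℂ) • Z) := by
  obtain ⟨ι, _, D, E, rfl, rfl, rfl⟩ := h
  have key : ∀ A B : Matrix n n ℂ, (r : ℂ) • (inl A * inr (conjM B)) =
      inl (((√r : ℝ) : ℂ) • A) * inr (conjM (((√r : ℝ) : ℂ) • B)) := by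
    intro A B
    rw [conjM_smul, map_smul, map_smul, smul_mul_smul_comm]
    congr 1
    simp only [RCLike.star_def, Complex.conj_ofReal, ← Complex.ofReal_mul, Real.mul_self_sqrt hr]
  exact ⟨ι, inferInstance, fun i => ((√r : ℝ) : ℂ) • D i, fun i => ((√r : ℝ) : ℂ) • E i,
    by simp [Finset.smul_sum, key], by simp [Finset.smul_sum, key],
    by simp [Finset.smul_sum, key]⟩

theorem mul (h : SchwarzTriple X Y Z) (h' : SchwarzTriple X' Y' Z') :
    SchwarzTriple (X * X') (Y * Y') (Z * Z') := by
  obtain ⟨ι, _, D, E, rfl, rfl, rfl⟩ := h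
  obtain ⟨ι', _, D', E', rfl, rfl, rfl⟩ := h'
  have key : ∀ A B A' B' : Matrix n n ℂ,
      inl A * inr (conjM B) * (inl A' * inr (conjM B')) =
        inl (A * A') * inr (conjM (B * B')) := by
    intro A B A' B'
    rw [map_mul, map_mul, map_mul, mul_assoc, ← mul_assoc (inr (conjM B)), inr_mul_inl]
    simp only [mul_assoc]
  exact ⟨ι × ι', inferInstance, fun i => D i.1 * D' i.2, fun i => E i.1 * E' i.2,
    by simp [Finset.sum_mul_sum, key, Fintype.sum_prod_type],
    by simp [Finset.sum_mul_sum, key, Fintype.sum_prod_type],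
    by simp [Finset.sum_mul_sum, key, Fintype.sum_prod_type]⟩

theorem pow (h : SchwarzTriple X Y Z) (N : ℕ) : SchwarzTriple (X ^ N) (Y ^ N) (Z ^ N) := by
  induction N with
  | zero => simpa using one
  | succ N ih => simpa [pow_succ] using ih.mul h

theorem sum {ι : Type*} (s : Finset ι) {X Y Z : ι → Matrix (n × n) (n × n) ℂ}
    (h : ∀ i ∈ s, SchwarzTriple (X i) (Y i) (Z i)) :
    SchwarzTriple (∑ i ∈ s, X i) (∑ i ∈ s, Y i) (∑ i ∈ s, Z i) := by
  classical
  induction s using Finset.induction_on with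
  | empty => simpa using zero
  | insert i s hi ih =>
    rw [Finset.sum_insert hi, Finset.sum_insert hi, Finset.sum_insert hi]
    exact (h i (Finset.mem_insert_self _ _)).add
      (ih fun j hj => h j (Finset.mem_insert_of_mem hj))

theorem norm_trace_sq_le (h : SchwarzTriple X Y Z) :
    ‖Y.trace‖ ^ 2 ≤ ‖X.trace‖ * ‖Z.trace‖ := by
  obtain ⟨ι, _, D, E, rfl, rfl, rfl⟩ := h
  have key : ∀ F : ι → Matrix n n ℂ,
      ‖(∑ i, inl (F i) * inr (conjM (F i))).trace‖ = ∑ i, ‖(F i).trace‖ ^ 2 := by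
    intro F
    have : (∑ i, inl (F i) * inr (conjM (F i))).trace =
        ((∑ i, ‖(F i).trace‖ ^ 2 : ℝ) : ℂ) := by
      rw [Matrix.trace_sum]
      push_cast
      refine Finset.sum_congr rfl fun i _ => ?_
      rw [trace_inl_mul_inr, trace_conjM, RCLike.star_def, Complex.mul_conj,
        Complex.normSq_eq_norm_sq]
      push_cast; rfl
    rw [this, Complex.norm_of_nonneg (by positivity)]
  rw [key, key]
  refine le_trans ?_ (Finset.sum_mul_sq_le_sq_mul_sq Finset.univ
    (fun i => ‖(D i).trace‖) (fun i => ‖(E i).trace‖))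
  refine pow_le_pow_left₀ (norm_nonneg _) ?_ 2
  rw [Matrix.trace_sum]
  refine (norm_sum_le _ _).trans (Finset.sum_le_sum fun i _ => ?_)
  rw [trace_inl_mul_inr, trace_conjM, norm_mul, norm_star]

end SchwarzTriple

theorem tendsto_trace_pow_exp [Nonempty n] {X : Matrix n n ℂ} {T : ℕ → Matrix n n ℂ}
    (hT : Tendsto (fun N : ℕ => (N : ℂ) • (T N - 1)) atTop (𝓝 X)) :
    Tendsto (fun N => ‖(T N ^ N).trace‖) atTop (𝓝 ‖(NormedSpace.exp X).trace‖) := by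
  have h : Tendsto (fun N => T N ^ N) atTop (𝓝 (NormedSpace.exp X)) := by
    open scoped Matrix.Norms.Operator in exact tendsto_pow_exp hT
  have hc : Continuous fun A : Matrix n n ℂ => ‖A.trace‖ := by fun_prop
  exact (hc.tendsto _).comp h

/-- The Schwarz inequality of reflection positivity: the trace of the exponential of
`A ⊗ 1 + 1 ⊗ B̄ + ∑ D ⊗ Ē` is bounded by the geometric mean of the two symmetric cases. -/
theorem norm_trace_exp_sq_le [Nonempty n] (A B : Matrix n n ℂ)
    {X Y Z : Matrix (n × n) (n × n) ℂ} (h : SchwarzTriple X Y Z) :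
    ‖(NormedSpace.exp (inl A + inr (conjM B) + Y)).trace‖ ^ 2 ≤
      ‖(NormedSpace.exp (inl A + inr (conjM A) + X)).trace‖ *
        ‖(NormedSpace.exp (inl B + inr (conjM B) + Z)).trace‖ := by
  -- `T A B Y N` is `1 + (A ⊗ 1 + 1 ⊗ B̄ + Y) / N + O(1 / N ^ 2)`, but its powers are sums of
  -- products `D ⊗ Ē`.
  let T (A B : Matrix n n ℂ) (Y : Matrix (n × n) (n × n) ℂ) (N : ℕ) :
      Matrix (n × n) (n × n) ℂ :=
    inl (1 + ((N : ℝ)⁻¹ : ℝ) • A) * inr (conjM (1 + ((N : ℝ)⁻¹ : ℝ) • B)) +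
      (((N : ℝ)⁻¹ : ℝ) : ℂ) • Y
  have lim : ∀ A B Y, Tendsto (fun N => ‖(T A B Y N ^ N).trace‖) atTop
      (𝓝 ‖(NormedSpace.exp (inl A + inr (conjM B) + Y)).trace‖) := by
    intro A B Y
    refine tendsto_trace_pow_exp ?_
    have h0 : Tendsto (fun N : ℕ => (N : ℂ)⁻¹ • (inl A * inr (conjM B))) atTop (𝓝 0) := by
      have := (tendsto_inv_atTop_nhds_zero_nat (𝕜 := ℂ)).smul_const (inl A * inr (conjM B))
      simpa using this
    have h1 := (tendsto_const_nhds (x := inl A + inr (conjM B) + Y)).add h0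
    rw [add_zero] at h1
    refine h1.congr' ?_
    filter_upwards [eventually_gt_atTop 0] with N hN
    have hN' : (N : ℂ) ≠ 0 := by exact_mod_cast hN.ne'
    have e : ∀ M : Matrix n n ℂ, ((N : ℝ)⁻¹ : ℝ) • M = (N : ℂ)⁻¹ • M := by
      intro M; ext i j; simp
    simp only [T, e, map_add, map_one, conjM_smul, map_smul, star_inv₀, star_natCast,
      Complex.ofReal_inv, Complex.ofReal_natCast]
    rw [add_mul, mul_add, mul_add, one_mul, mul_one, one_mul, smul_mul_smul_comm]
    rw [show ∀ a b c d : Matrix (n × n) (n × n) ℂ, 1 + a + (b + c) + d - 1 = b + a + d + c by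
      intros; abel]
    simp only [smul_add, smul_smul, mul_inv_cancel₀ hN', one_smul, mul_inv_cancel_left₀ hN']
  have key : ∀ N, ‖(T A B Y N ^ N).trace‖ ^ 2 ≤
      ‖(T A A X N ^ N).trace‖ * ‖(T B B Z N ^ N).trace‖ := fun N =>
    (((SchwarzTriple.of_pair _ _).add (h.smul (by positivity))).pow N).norm_trace_sq_le
  exact le_of_tendsto_of_tendsto' ((lim A B Y).pow 2) ((lim A A X).mul (lim B B Z)) key

end

/-! ### The canonical anticommutation relations on Fock space -/

/-- The canonical anticommutation relations for the annihilation operators `c i`. -/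
structure IsCAR {ι κ : Type*} [DecidableEq ι] [Fintype κ] [DecidableEq κ]
    (c : ι → Matrix κ κ ℂ) : Prop where
  anti : ∀ i j, c i * c j + c j * c i = 0
  mixed : ∀ i j, c i * (c j)ᴴ + (c j)ᴴ * c i = if i = j then 1 else 0

section Fock

variable {ι : Type*} {n : ℕ} (e : ι ≃ Fin n)

/-- The sign that `a_i` and `a_i†` pick up from the occupied modes preceding `i`. -/
def fockSign (i : ι) (S : Finset ι) : ℂ := (-1) ^ {j ∈ S | e j < e i}.card

theorem fockSign_mul_self (i : ι) (S : Finset ι) : fockSign e i S * fockSign e i S = 1 := by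
  rw [fockSign, ← mul_pow]; simp

theorem star_fockSign (i : ι) (S : Finset ι) : star (fockSign e i S) = fockSign e i S := by
  simp [fockSign]

variable [DecidableEq ι]

theorem fockSign_insert {i j : ι} {S : Finset ι} (h : j ∉ S) :
    fockSign e i (insert j S) = (if e j < e i then -1 else 1) * fockSign e i S := by
  rw [fockSign, fockSign, Finset.filter_insert]
  split_ifs with h1
  · rw [Finset.card_insert_of_notMem (by simp [h]), pow_succ]; ring
  · simp

theorem fockSign_erase {i j : ι} {S : Finset ι} (h : j ∈ S) :
    fockSign e i (S.erase j) = (if e j < e i then -1 else 1) * fockSign e i S := by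
  conv_rhs => rw [← Finset.insert_erase h, fockSign_insert e (Finset.notMem_erase j S)]
  split_ifs <;> ring

theorem annihilate_apply (i : ι) (T S : Finset ι) :
    annihilate e i T S = if i ∈ S ∧ T = S.erase i then fockSign e i S else 0 := rfl

theorem annihilate_conjTranspose_apply (i : ι) (T S : Finset ι) :
    (annihilate e i)ᴴ T S = if i ∉ S ∧ T = insert i S then fockSign e i S else 0 := by
  rw [Matrix.conjTranspose_apply, annihilate_apply]
  by_cases h : i ∉ S ∧ T = insert i S
  · obtain ⟨h1, rfl⟩ := h
    rw [if_pos ⟨Finset.mem_insert_self _ _, (Finset.erase_insert h1).symm⟩, if_pos ⟨h1, rfl⟩,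
      star_fockSign, fockSign_insert e h1]
    simp
  · rw [if_neg h, if_neg, star_zero]
    rintro ⟨h1, rfl⟩
    exact h ⟨Finset.notMem_erase _ _, (Finset.insert_erase h1).symm⟩

/-- The fermion parity `(-1) ^ N`. -/
def fermionParity (ι : Type*) [DecidableEq ι] : FockOp ι :=
  Matrix.diagonal fun S => (-1) ^ S.card

theorem fermionParity_conjTranspose : (fermionParity ι)ᴴ = fermionParity ι := by
  rw [fermionParity, Matrix.diagonal_conjTranspose]
  congr 1; ext S; simp

variable [Fintype ι]

theorem mul_annihilate_apply {κ : Type*} (M : Matrix κ (Finset ι) ℂ) (i : ι) (k : κ)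
    (S : Finset ι) : (M * annihilate e i) k S =
      if i ∈ S then M k (S.erase i) * fockSign e i S else 0 := by
  simp only [Matrix.mul_apply, annihilate_apply]
  by_cases h : i ∈ S <;> simp [h]

theorem mul_annihilate_conjTranspose_apply {κ : Type*} (M : Matrix κ (Finset ι) ℂ) (i : ι) (k : κ)
    (S : Finset ι) : (M * (annihilate e i)ᴴ) k S =
      if i ∉ S then M k (insert i S) * fockSign e i S else 0 := by
  simp only [Matrix.mul_apply, annihilate_conjTranspose_apply]
  by_cases h : i ∈ S <;> simp [h]

theorem isCAR_annihilate : IsCAR (annihilate e) where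
  anti i j := by
    ext T S
    rw [Matrix.add_apply, mul_annihilate_apply, mul_annihilate_apply, annihilate_apply,
      annihilate_apply, Matrix.zero_apply]
    rcases eq_or_ne i j with rfl | hij
    · simp
    by_cases hi : i ∈ S
    swap; · simp [hi]
    by_cases hj : j ∈ S
    swap; · simp [hj]
    simp only [hi, hj, Finset.mem_erase, ne_eq, hij, hij.symm, not_false_eq_true, true_and, if_true,
      Finset.erase_right_comm (a := i) (b := j), fockSign_erase e hi, fockSign_erase e hj]
    have : e i ≠ e j := fun h => hij (e.injective h)
    rcases lt_or_gt_of_ne this with h | h <;> simp only [h, h.not_gt, if_true, if_false] <;>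
      split_ifs <;> ring
  mixed i j := by
    ext T S
    rw [Matrix.add_apply, mul_annihilate_apply, mul_annihilate_conjTranspose_apply,
      annihilate_apply, annihilate_conjTranspose_apply]
    rcases eq_or_ne i j with rfl | hij
    · by_cases hi : i ∈ S
      · simp [hi, fockSign_erase e hi, fockSign_mul_self, Matrix.one_apply]
      · simp [hi, fockSign_insert e hi, fockSign_mul_self, Matrix.one_apply]
    by_cases hi : i ∈ S
    swap; · simp [hi, hij]
    by_cases hj : j ∈ S
    · simp [hi, hj, hij, hij.symm]
    simp only [hi, hj, Finset.mem_erase, Finset.mem_insert, ne_eq, hij, hij.symm, not_false_eq_true,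
      true_and, if_true, or_true, and_false, if_false, fockSign_erase e hi, fockSign_insert e hj,
      Finset.erase_insert_of_ne (Ne.symm hij), Matrix.zero_apply]
    have : e i ≠ e j := fun h => hij (e.injective h)
    rcases lt_or_gt_of_ne this with h | h <;> simp only [h, h.not_gt, if_true, if_false] <;>
      split_ifs <;> ring

theorem conjM_annihilate (i : ι) : conjM (annihilate e i) = annihilate e i := by
  ext T S
  simp only [conjM, RingHom.mapMatrix_apply, Matrix.map_apply, annihilate_apply]
  split_ifs
  · exact star_fockSign e i S
  · simp

theorem fermionParity_mul_self : fermionParity ι * fermionParity ι = 1 := by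
  rw [fermionParity, Matrix.diagonal_mul_diagonal, ← Matrix.diagonal_one]
  congr 1; ext S; rw [← mul_pow]; simp

theorem fermionParity_mul_annihilate (i : ι) :
    fermionParity ι * annihilate e i = -(annihilate e i * fermionParity ι) := by
  ext T S
  rw [Matrix.neg_apply, fermionParity, Matrix.diagonal_mul, Matrix.mul_diagonal, annihilate_apply]
  split_ifs with h
  · obtain ⟨h1, rfl⟩ := h
    rw [← Finset.card_erase_add_one h1, pow_succ]; ring
  · simp

end Fock

/-! ### Uniqueness of the representation of the anticommutation relations -/

namespace IsCAR

open Matrix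

variable {ι κ : Type*} [DecidableEq ι] [Fintype κ] [DecidableEq κ] {c : ι → Matrix κ κ ℂ}

/-- Applying to some vector the annihilation operators that do not annihilate it yields a vector
that all of them annihilate. -/
theorem exists_vacuum [Fintype ι] [Nonempty κ] (hc : IsCAR c) :
    ∃ v : κ → ℂ, star v ⬝ᵥ v = 1 ∧ ∀ i, c i *ᵥ v = 0 := by
  have key : ∀ s : Finset ι, ∃ v : κ → ℂ, v ≠ 0 ∧ ∀ i ∈ s, c i *ᵥ v = 0 := by
    intro s
    induction s using Finset.induction_on with
    | empty =>
      exact ⟨fun _ => 1, fun h => one_ne_zero (congrFun h (Classical.arbitrary κ)), by simp⟩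
    | insert j s hj ih =>
      obtain ⟨v, hv, h⟩ := ih
      by_cases hjv : c j *ᵥ v = 0
      · exact ⟨v, hv, by simpa [hjv] using h⟩
      refine ⟨c j *ᵥ v, hjv, fun i hi => ?_⟩
      have hanti : c i *ᵥ (c j *ᵥ v) = -(c j *ᵥ (c i *ᵥ v)) := by
        rw [mulVec_mulVec, mulVec_mulVec, eq_neg_iff_add_eq_zero, ← add_mulVec, hc.anti,
          zero_mulVec]
      rcases Finset.mem_insert.1 hi with rfl | hi
      · exact self_eq_neg.1 hanti
      · rw [hanti, h i hi, mulVec_zero, neg_zero]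
  obtain ⟨v, hv, h⟩ := key Finset.univ
  have hpos : 0 < star v ⬝ᵥ v := dotProduct_star_self_pos_iff.2 hv
  obtain ⟨hre, him⟩ := Complex.pos_iff.1 hpos
  set r : ℝ := (star v ⬝ᵥ v).re
  have hr : star v ⬝ᵥ v = (r : ℂ) := Complex.ext rfl (by simp [him])
  refine ⟨(((√r)⁻¹ : ℝ) : ℂ) • v, ?_, fun i => by
    rw [mulVec_smul, h i (Finset.mem_univ _), smul_zero]⟩
  rw [star_smul, smul_dotProduct, dotProduct_smul, hr, RCLike.star_def, Complex.conj_ofReal]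
  simp only [smul_eq_mul, ← Complex.ofReal_mul]
  rw [← Complex.ofReal_one]
  congr 1
  have : √r ≠ 0 := (Real.sqrt_pos.2 hre).ne'
  field_simp
  exact (Real.sq_sqrt hre.le).symm

/-- The vector obtained from `v` by creating the modes in `l`, the last one first. -/
def createList (c : ι → Matrix κ κ ℂ) (v : κ → ℂ) (l : List ι) : κ → ℂ :=
  l.foldr (fun j w => (c j)ᴴ *ᵥ w) v

variable {n : ℕ} (e : ι ≃ Fin n) {v : κ → ℂ}

theorem mulVec_createList (hc : IsCAR c) (hv : ∀ i, c i *ᵥ v = 0) (i : ι) {l : List ι}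
    (hl : l.Pairwise fun j k => e j < e k) :
    c i *ᵥ createList c v l = if i ∈ l then
      (-1 : ℂ) ^ (l.filter fun j => e j < e i).length • createList c v (l.erase i) else 0 := by
  induction l with
  | nil => simpa [createList] using hv i
  | cons j l ih =>
    obtain ⟨hj, hl'⟩ := List.pairwise_cons.1 hl
    have hstep : c i *ᵥ createList c v (j :: l) =
        (if i = j then createList c v l else 0) - (c j)ᴴ *ᵥ (c i *ᵥ createList c v l) := by
      change c i *ᵥ ((c j)ᴴ *ᵥ createList c v l) = _
      rw [mulVec_mulVec, mulVec_mulVec, eq_sub_iff_add_eq, ← add_mulVec, hc.mixed]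
      split_ifs <;> simp
    rw [hstep, ih hl']
    rcases eq_or_ne i j with rfl | hij
    · have h1 : i ∉ l := fun h => lt_irrefl _ (hj i h)
      have h2 : (l.filter fun j => e j < e i) = [] := by
        rw [List.filter_eq_nil_iff]
        intro k hk
        simpa using (hj k hk).le
      simp [h1, h2]
    · by_cases hi : i ∈ l
      · have h1 := hj i hi
        rw [if_neg hij, if_pos hi, if_pos (List.mem_cons_of_mem _ hi),
          List.erase_cons_tail (by simpa using hij.symm),
          List.filter_cons_of_pos (by simpa using h1), List.length_cons, pow_succ, mulVec_smul]
        simp [createList]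
      · simp [hi, hij]

theorem star_createList_dotProduct (hc : IsCAR c) (hv1 : star v ⬝ᵥ v = 1)
    (hv : ∀ i, c i *ᵥ v = 0) {l l' : List ι}
    (hl : l.Pairwise fun j k => e j < e k) (hl' : l'.Pairwise fun j k => e j < e k) :
    star (createList c v l) ⬝ᵥ createList c v l' = if l = l' then 1 else 0 := by
  have hadj : ∀ (j : ι) (w w' : κ → ℂ), star ((c j)ᴴ *ᵥ w) ⬝ᵥ w' = star w ⬝ᵥ (c j *ᵥ w') := by
    intro j w w'
    rw [star_mulVec, conjTranspose_conjTranspose, dotProduct_mulVec]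
  induction l generalizing l' with
  | nil =>
    cases l' with
    | nil => simpa [createList] using hv1
    | cons k l' =>
      rw [if_neg (by simp)]
      change star v ⬝ᵥ ((c k)ᴴ *ᵥ createList c v l') = 0
      rw [← star_star (star v ⬝ᵥ _), star_dotProduct, star_star, hadj, hv]
      simp
  | cons j l ih =>
    obtain ⟨hj, hl1⟩ := List.pairwise_cons.1 hl
    change star ((c j)ᴴ *ᵥ createList c v l) ⬝ᵥ createList c v l' = _
    rw [hadj, mulVec_createList e hc hv j hl']
    by_cases hjl : j ∈ l'
    · rw [if_pos hjl, dotProduct_smul, ih hl1 (hl'.sublist List.erase_sublist)]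
      by_cases h : j :: l = l'
      · subst h
        have h2 : (l.filter fun k => e k < e j) = [] := by
          rw [List.filter_eq_nil_iff]
          intro k hk
          simpa using (hj k hk).le
        simp [h2]
      · rw [if_neg h, if_neg, smul_zero]
        rintro rfl
        exact h (List.Perm.eq_of_pairwise (fun a b _ _ h1 h2 => absurd h1 h2.not_gt) hl hl'
          (List.perm_cons_erase hjl).symm)
    · rw [if_neg hjl, dotProduct_zero, if_neg]
      rintro rfl
      exact hjl List.mem_cons_self

/-- Any representation of the anticommutation relations on a space of the dimension of the Fock
space is unitarily equivalent to the Fock representation. -/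
theorem exists_unitary [Fintype ι] (hc : IsCAR c)
    (hcard : Fintype.card κ = Fintype.card (Finset ι)) :
    ∃ U : Matrix κ (Finset ι) ℂ, Uᴴ * U = 1 ∧ U * Uᴴ = 1 ∧
      ∀ i, c i = U * annihilate e i * Uᴴ := by
  have : Nonempty κ := Fintype.card_pos_iff.1 (hcard ▸ Fintype.card_pos)
  obtain ⟨v, hv1, hv⟩ := hc.exists_vacuum
  have hex : ∀ T : Finset ι, ∃ l : List ι, l.toFinset = T ∧ l.Pairwise fun j k => e j < e k := by
    intro T
    refine ⟨((T.map e.toEmbedding).sort).map e.symm, ?_, ?_⟩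
    · ext i
      simp only [List.mem_toFinset, List.mem_map, Finset.mem_sort, Finset.mem_map_equiv]
      exact ⟨fun ⟨a, h1, h2⟩ => h2 ▸ h1, fun h => ⟨e i, by simpa using h, by simp⟩⟩
    · rw [List.pairwise_map]
      simpa using (Finset.sortedLT_sort (T.map e.toEmbedding)).pairwise
  choose l hlT hl using hex
  have hnd : ∀ T, (l T).Nodup := fun T => (hl T).imp fun h h' => (h' ▸ h).ne rfl
  have hmem : ∀ i T, i ∈ l T ↔ i ∈ T := fun i T => by rw [← List.mem_toFinset, hlT]
  have herase : ∀ i T, l (T.erase i) = (l T).erase i := by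
    intro i T
    refine List.Perm.eq_of_pairwise (fun a b _ _ h1 h2 => absurd h1 h2.not_gt) (hl _)
      ((hl T).sublist List.erase_sublist) ?_
    rw [List.perm_ext_iff_of_nodup (hnd _) ((hnd _).erase _)]
    intro j
    rw [hmem, (hnd T).mem_erase_iff, hmem, Finset.mem_erase]
  have hsign : ∀ i T, (-1 : ℂ) ^ ((l T).filter fun j => e j < e i).length = fockSign e i T := by
    intro i T
    rw [fockSign]
    congr 1
    rw [← List.toFinset_card_of_nodup ((hnd T).filter _), List.toFinset_filter, hlT]
    simp
  let U : Matrix κ (Finset ι) ℂ := Matrix.of fun k T => createList c v (l T) k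
  have hU : Uᴴ * U = 1 := by
    ext T T'
    have := star_createList_dotProduct e hc hv1 hv (hl T) (hl T')
    rw [Matrix.mul_apply', Matrix.one_apply]
    refine this.trans ?_
    have : l T = l T' ↔ T = T' := ⟨fun h => by rw [← hlT T, h, hlT], fun h => h ▸ rfl⟩
    simp only [this]
  have hU' : U * Uᴴ = 1 := (Matrix.mul_eq_one_comm_of_card_eq _ _ _ hcard.symm).1 hU
  refine ⟨U, hU, hU', fun i => ?_⟩
  have h : c i * U = U * annihilate e i := by
    ext k T
    have h1 : (c i * U) k T = (c i *ᵥ createList c v (l T)) k := rfl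
    rw [mul_annihilate_apply, h1, mulVec_createList e hc hv i (hl T), hsign, ← herase]
    simp only [hmem]
    split_ifs
    · simp [U, mul_comm]
    · rfl
  rw [← h, Matrix.mul_assoc, hU', Matrix.mul_one]

/-- The Fock representation can be carried to any other representation of the anticommutation
relations on a space of the same dimension, without changing the trace of an exponential. -/
theorem exists_starAlgHom [Fintype ι] (hc : IsCAR c)
    (hcard : Fintype.card κ = Fintype.card (Finset ι)) :
    ∃ φ : FockOp ι →⋆ₐ[ℂ] Matrix κ κ ℂ, (∀ i, φ (annihilate e i) = c i) ∧
      ∀ A, (NormedSpace.exp (φ A)).trace = (NormedSpace.exp A).trace := by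
  obtain ⟨U, hU, hU', h⟩ := hc.exists_unitary e hcard
  let φ : FockOp ι →⋆ₐ[ℂ] Matrix κ κ ℂ :=
    { toFun := fun A => U * A * Uᴴ
      map_one' := by rw [Matrix.mul_one, hU']
      map_mul' := fun A B => by
        simp only [Matrix.mul_assoc]
        rw [← Matrix.mul_assoc Uᴴ U, hU, Matrix.one_mul]
      map_zero' := by simp
      map_add' := fun A B => by rw [Matrix.mul_add, Matrix.add_mul]
      commutes' := fun z => by
        rw [Algebra.algebraMap_eq_smul_one, Algebra.algebraMap_eq_smul_one, Matrix.mul_smul,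
          Matrix.smul_mul, Matrix.mul_one, hU']
      map_star' := fun A => by
        simp [Matrix.star_eq_conjTranspose, Matrix.mul_assoc] }
  refine ⟨φ, fun i => (h i).symm, fun A => ?_⟩
  have hexp : φ (NormedSpace.exp A) = NormedSpace.exp (φ A) := by
    open scoped Matrix.Norms.Operator in
    exact NormedSpace.map_exp φ
      (LinearMap.continuous_of_finiteDimensional φ.toAlgHom.toLinearMap) A
  rw [← hexp]
  change (U * NormedSpace.exp A * Uᴴ).trace = _
  rw [Matrix.trace_mul_comm, ← Matrix.mul_assoc, hU, Matrix.one_mul]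

end IsCAR

open Complex (I)

/-! ### Hamiltonians on a system of bonds -/

section Operators

variable {X κ : Type*} [Fintype κ] (c : X → Fin 2 → Matrix κ κ ℂ)

/-- The hopping operator of a pair of sites, for the family `c` of annihilation operators. -/
def hopOp (x y : X) : Matrix κ κ ℂ := ∑ σ, ((c x σ)ᴴ * c y σ - (c y σ)ᴴ * c x σ)

/-- The operator `Γ⁽¹⁾` at a site, for the family `c` of annihilation operators. -/
def pair₁ (x : X) : Matrix κ κ ℂ := (c x 0)ᴴ * (c x 1)ᴴ + c x 1 * c x 0

/-- The operator `Γ⁽²⁾` at a site, for the family `c` of annihilation operators. -/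
def pair₂ (x : X) : Matrix κ κ ℂ := I • ((c x 0)ᴴ * (c x 1)ᴴ - c x 1 * c x 0)

theorem hopOp_conjTranspose (x y : X) : (hopOp c x y)ᴴ = -hopOp c x y := by
  simp only [hopOp, Matrix.conjTranspose_sum, Matrix.conjTranspose_sub, Matrix.conjTranspose_mul,
    Matrix.conjTranspose_conjTranspose, ← Finset.sum_neg_distrib, neg_sub]

theorem hopOp_swap (x y : X) : hopOp c y x = -hopOp c x y := by
  simp only [hopOp, ← Finset.sum_neg_distrib, neg_sub]

theorem pair₁_conjTranspose (x : X) : (pair₁ c x)ᴴ = pair₁ c x := by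
  simp only [pair₁, Matrix.conjTranspose_add, Matrix.conjTranspose_mul,
    Matrix.conjTranspose_conjTranspose]
  exact add_comm _ _

theorem pair₂_conjTranspose (x : X) : (pair₂ c x)ᴴ = pair₂ c x := by
  simp only [pair₂, Matrix.conjTranspose_smul, Matrix.conjTranspose_sub, Matrix.conjTranspose_mul,
    Matrix.conjTranspose_conjTranspose, RCLike.star_def, Complex.conj_I, neg_smul, ← smul_neg,
    neg_sub]

variable [DecidableEq κ] {κ' : Type*} [Fintype κ'] [DecidableEq κ']
  (φ : Matrix κ κ ℂ →⋆ₐ[ℂ] Matrix κ' κ' ℂ)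

theorem starAlgHom_conjTranspose (A : Matrix κ κ ℂ) : φ Aᴴ = (φ A)ᴴ := map_star φ A

theorem map_hopOp (x y : X) : φ (hopOp c x y) = hopOp (fun x σ => φ (c x σ)) x y := by
  simp [hopOp, starAlgHom_conjTranspose]

theorem map_pair₁ (x : X) : φ (pair₁ c x) = pair₁ (fun x σ => φ (c x σ)) x := by
  simp [pair₁, starAlgHom_conjTranspose]

theorem map_pair₂ (x : X) : φ (pair₂ c x) = pair₂ (fun x σ => φ (c x σ)) x := by
  simp [pair₂, starAlgHom_conjTranspose]

end Operators

/-- A lattice with sites `X` and oriented bonds `E`, with a hopping amplitude on each bond and a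
pairing field on each site. -/
structure BondSystem (X E : Type*) where
  /-- The first endpoint of a bond. -/
  src : E → X
  /-- The second endpoint of a bond. -/
  tgt : E → X
  /-- The hopping amplitude, without the factor `i`. -/
  amp : E → ℝ
  /-- The field that couples to `Γ⁽²⁾`. -/
  field : X → ℝ
  /-- The strength of the interaction. -/
  coupling : ℝ
  /-- The coefficient of the one-site terms of the interaction. -/
  onsite : ℝ

namespace BondSystem

variable {X E : Type*} (G : BondSystem X E)

section Energy

variable {κ : Type*} [Fintype κ] [DecidableEq κ] (c : X → Fin 2 → Matrix κ κ ℂ)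

/-- The part of the Hamiltonian belonging to the bond `b`, with the number `k` added to the sum
of the two operators `Γ⁽¹⁾`. -/
def bondTerm (k : ℝ) (b : E) : Matrix κ κ ℂ :=
  (I * (G.amp b : ℂ)) • hopOp c (G.src b) (G.tgt b) +
    ((G.coupling / 4 : ℝ) : ℂ) • ((pair₁ c (G.src b) + pair₁ c (G.tgt b) + (k : ℂ) • 1) ^ 2 -
      (pair₂ c (G.src b) - pair₂ c (G.tgt b)) ^ 2)

/-- The part of the Hamiltonian belonging to the site `x`. -/
def siteTerm (x : X) : Matrix κ κ ℂ :=
  -((G.onsite : ℂ) • (pair₁ c x ^ 2 - pair₂ c x ^ 2)) - (G.field x : ℂ) • pair₂ c x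

variable [Fintype X] [Fintype E]

/-- The Hamiltonian with the numbers `k b` added in the bond terms. -/
def energy (k : E → ℝ) : Matrix κ κ ℂ := ∑ b, G.bondTerm c (k b) b + ∑ x, G.siteTerm c x

theorem map_energy {κ' : Type*} [Fintype κ'] [DecidableEq κ']
    (φ : Matrix κ κ ℂ →⋆ₐ[ℂ] Matrix κ' κ' ℂ) (k : E → ℝ) :
    φ (G.energy c k) = G.energy (fun x σ => φ (c x σ)) k := by
  simp only [energy, bondTerm, siteTerm, map_sum, map_add, map_sub, map_neg, map_smul, map_pow,
    map_one, map_hopOp, map_pair₁, map_pair₂]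

theorem isHermitian_energy (k : E → ℝ) : (G.energy c k).IsHermitian := by
  simp only [Matrix.IsHermitian, energy, bondTerm, siteTerm, Matrix.conjTranspose_add,
    Matrix.conjTranspose_sub, Matrix.conjTranspose_neg, Matrix.conjTranspose_sum,
    Matrix.conjTranspose_smul, Matrix.conjTranspose_pow, hopOp_conjTranspose,
    pair₁_conjTranspose, pair₂_conjTranspose, Matrix.conjTranspose_one, RCLike.star_def, map_mul,
    Complex.conj_I, Complex.conj_ofReal, smul_neg, neg_mul, neg_smul, neg_neg]

/-- The partition function at inverse temperature `β`. -/
def partitionFunction (β : ℝ) (k : E → ℝ) : ℂ :=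
  (NormedSpace.exp (-(β : ℂ) • G.energy c k)).trace

theorem partitionFunction_nonneg (β : ℝ) (k : E → ℝ) : 0 ≤ G.partitionFunction c β k := by
  have h : (-((β / 2 : ℝ) : ℂ) • G.energy c k).IsHermitian := by
    rw [Matrix.IsHermitian, Matrix.conjTranspose_smul, G.isHermitian_energy]
    simp
  have e : -(β : ℂ) • G.energy c k =
      2 • (-((β / 2 : ℝ) : ℂ) • G.energy c k) := by
    rw [← Nat.cast_smul_eq_nsmul ℂ, smul_smul]
    congr 1
    push_cast; ring
  rw [partitionFunction, e, Matrix.exp_nsmul, sq]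
  nth_rewrite 1 [← h.exp]
  exact (Matrix.posSemidef_conjTranspose_mul_self _).trace_nonneg

end Energy

/-! ### Reflections of a system of bonds -/

/-- A reflection that exchanges the two halves of a system of bonds, such that the bonds between
the two halves join mirror images. -/
structure Reflection where
  /-- The left half. -/
  left : X → Prop
  /-- The mirror image of a site. -/
  refl : X → X
  /-- The mirror image of a bond, possibly with the opposite orientation. -/
  reflBond : E → E
  /-- The signs with which a particle-hole transformation of the right half turns the Hamiltonian
  of the right half into the complex conjugate of the Hamiltonian of the left half. -/
  sign : X → ℝ
  refl_refl : ∀ x, refl (refl x) = x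
  left_refl : ∀ x, left (refl x) ↔ ¬ left x
  reflBond_reflBond : ∀ b, reflBond (reflBond b) = b
  sign_mul_self : ∀ x, sign x * sign x = 1
  field_refl : ∀ x, G.field (refl x) = -G.field x
  /-- A bond is reflected either with its orientation, or with the opposite orientation, in which
  case the signs matter only if it lies in one of the halves. -/
  bond : ∀ b,
    (G.src (reflBond b) = refl (G.src b) ∧ G.tgt (reflBond b) = refl (G.tgt b) ∧
      G.amp (reflBond b) * (sign (refl (G.src b)) * sign (refl (G.tgt b))) = -G.amp b) ∨
    (G.src (reflBond b) = refl (G.tgt b) ∧ G.tgt (reflBond b) = refl (G.src b) ∧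
      ((left (G.src b) ↔ left (G.tgt b)) →
        G.amp (reflBond b) * (sign (refl (G.src b)) * sign (refl (G.tgt b))) = G.amp b))
  /-- With this sign, the hopping across a bond that leaves the left half has a coefficient for
  which reflection positivity holds. -/
  crossing_left : ∀ b, left (G.src b) → ¬ left (G.tgt b) →
    G.tgt b = refl (G.src b) ∧ 0 ≤ G.amp b * sign (G.tgt b)
  /-- The same for a bond that enters the left half; the opposite sign comes from the
  antisymmetry of the hopping operator. -/
  crossing_right : ∀ b, ¬ left (G.src b) → left (G.tgt b) →
    G.tgt b = refl (G.src b) ∧ G.amp b * sign (G.src b) ≤ 0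

end BondSystem

/-! ### Odd operators on a doubled Fock space -/

section Odd

variable {ι : Type*} [DecidableEq ι] [Fintype ι]

/-- Operators that anticommute with the fermion parity. -/
def IsOdd (A : FockOp ι) : Prop := fermionParity ι * A = -(A * fermionParity ι)

theorem IsOdd.conjTranspose {A : FockOp ι} (h : IsOdd A) : IsOdd Aᴴ := by
  have := congrArg Matrix.conjTranspose h
  rw [Matrix.conjTranspose_mul, Matrix.conjTranspose_neg, Matrix.conjTranspose_mul,
    fermionParity_conjTranspose] at this
  rw [IsOdd, this, neg_neg]

/-- The copy of an odd operator on the left half. The parity and the factor `i` change neither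
the products of two such operators nor the adjoint, but they turn the product with
`oddRight B` into `i A ⊗ B`. -/
def oddLeft (A : FockOp ι) : Matrix (Finset ι × Finset ι) (Finset ι × Finset ι) ℂ :=
  inl (I • (A * fermionParity ι))

/-- The copy of an odd operator on the right half; the parity of the left half makes it
anticommute with the odd operators there. -/
def oddRight (A : FockOp ι) : Matrix (Finset ι × Finset ι) (Finset ι × Finset ι) ℂ :=
  inl (fermionParity ι) * inr A

theorem oddLeft_conjTranspose {A : FockOp ι} (h : IsOdd A) : (oddLeft A)ᴴ = oddLeft Aᴴ := by
  rw [oddLeft, oddLeft, inl_conjTranspose, Matrix.conjTranspose_smul, Matrix.conjTranspose_mul,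
    fermionParity_conjTranspose, h.conjTranspose]
  simp

theorem oddRight_conjTranspose (A : FockOp ι) : (oddRight A)ᴴ = oddRight Aᴴ := by
  rw [oddRight, oddRight, Matrix.conjTranspose_mul, inl_conjTranspose, inr_conjTranspose,
    fermionParity_conjTranspose, inr_mul_inl]

theorem oddLeft_mul_oddLeft (A : FockOp ι) {B : FockOp ι} (h : IsOdd B) :
    oddLeft A * oddLeft B = inl (A * B) := by
  rw [oddLeft, oddLeft, ← map_mul, smul_mul_smul_comm, Complex.I_mul_I, neg_one_smul,
    mul_assoc A, ← mul_assoc _ B, h, neg_mul, mul_assoc B, fermionParity_mul_self]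
  simp

theorem oddRight_mul_oddRight (A B : FockOp ι) : oddRight A * oddRight B = inr (A * B) := by
  rw [oddRight, oddRight, mul_assoc, ← mul_assoc (inr A), inr_mul_inl, mul_assoc, ← map_mul,
    ← mul_assoc, ← map_mul, fermionParity_mul_self, map_one, one_mul]

theorem oddLeft_mul_oddRight (A B : FockOp ι) : oddLeft A * oddRight B = I • (inl A * inr B) := by
  rw [oddLeft, oddRight, ← mul_assoc, ← map_mul, smul_mul_assoc, mul_assoc,
    fermionParity_mul_self, mul_one, map_smul, smul_mul_assoc]

theorem oddRight_mul_oddLeft {A : FockOp ι} (h : IsOdd A) (B : FockOp ι) :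
    oddRight B * oddLeft A = -(I • (inl A * inr B)) := by
  rw [oddLeft, oddRight, mul_assoc, inr_mul_inl, ← mul_assoc, ← map_mul, mul_smul_comm,
    ← mul_assoc, h, neg_mul, mul_assoc, fermionParity_mul_self, mul_one, map_smul, map_neg,
    smul_neg, neg_mul, smul_mul_assoc]

end Odd

/-! ### The doubled representation -/

namespace BondSystem.Reflection

variable {X E : Type*} {G : BondSystem X E} (R : G.Reflection) [DecidablePred R.left]

/-- The site of the left half that agrees with `x` up to the reflection. -/
def fold (x : X) : {x // R.left x} :=
  if h : R.left x then ⟨x, h⟩ else ⟨R.refl x, (R.left_refl x).2 h⟩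

theorem fold_refl (x : X) : R.fold (R.refl x) = R.fold x := by
  by_cases h : R.left x
  · have h' : ¬ R.left (R.refl x) := fun h2 => (R.left_refl x).1 h2 h
    simp only [fold, dif_pos h, dif_neg h', R.refl_refl]
  · simp only [fold, dif_neg h, dif_pos ((R.left_refl x).2 h)]

theorem fold_eq_fold {x y : X} (h : R.left x ↔ R.left y) : R.fold x = R.fold y ↔ x = y := by
  refine ⟨fun hf => ?_, fun h => h ▸ rfl⟩
  by_cases hx : R.left x
  · simpa [fold, hx, h.1 hx] using hf
  · have hy : ¬ R.left y := fun h2 => hx (h.2 h2)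
    have : R.refl x = R.refl y := by simpa [fold, hx, hy] using hf
    rw [← R.refl_refl x, this, R.refl_refl]

/-- The modes of the left half. -/
abbrev LeftMode : Type _ := {x // R.left x} × Fin 2

variable [Fintype X]

theorem card_doubled : Fintype.card (Finset R.LeftMode × Finset R.LeftMode) =
    Fintype.card (Finset (X × Fin 2)) := by
  have e : {x // R.left x} ≃ {x // ¬ R.left x} :=
    { toFun := fun x => ⟨R.refl x, fun h => (R.left_refl x).1 h x.2⟩
      invFun := fun x => ⟨R.refl x, (R.left_refl x).2 x.2⟩
      left_inv := fun x => Subtype.ext (R.refl_refl x)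
      right_inv := fun x => Subtype.ext (R.refl_refl x) }
  have h : Fintype.card X = Fintype.card {x // R.left x} + Fintype.card {x // R.left x} := by
    nth_rewrite 2 [Fintype.card_congr e]
    rw [← Fintype.card_sum]
    exact Fintype.card_congr (Equiv.sumCompl R.left).symm
  rw [Fintype.card_prod, Fintype.card_finset, Fintype.card_finset, ← pow_add, Fintype.card_prod,
    Fintype.card_prod, h]
  ring

variable [DecidableEq X]

/-- The annihilation operators of the left half, labelled by all sites through the reflection. -/
def leftOp (x : X) (σ : Fin 2) : FockOp R.LeftMode :=
  annihilate (Fintype.equivFin R.LeftMode) (R.fold x, σ)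

theorem leftOp_refl (x : X) : R.leftOp (R.refl x) = R.leftOp x := by
  funext σ
  rw [leftOp, leftOp, fold_refl]

theorem isOdd_leftOp (x : X) (σ : Fin 2) : IsOdd (R.leftOp x σ) :=
  fermionParity_mul_annihilate _ _

theorem conjM_leftOp (x : X) (σ : Fin 2) : conjM (R.leftOp x σ) = R.leftOp x σ :=
  conjM_annihilate _ _

/-- The annihilation operators of the whole system on the doubled Fock space of the left half,
with a particle-hole transformation on the right half. -/
def doubledOp (x : X) (σ : Fin 2) :
    Matrix (Finset R.LeftMode × Finset R.LeftMode) (Finset R.LeftMode × Finset R.LeftMode) ℂ :=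
  if R.left x then oddLeft (R.leftOp x σ) else (R.sign x : ℂ) • oddRight (R.leftOp x σ)ᴴ

variable {R} in
theorem doubledOp_of_left {x : X} (h : R.left x) (σ : Fin 2) :
    R.doubledOp x σ = oddLeft (R.leftOp x σ) := if_pos h

variable {R} in
theorem doubledOp_of_not_left {x : X} (h : ¬ R.left x) (σ : Fin 2) :
    R.doubledOp x σ = (R.sign x : ℂ) • oddRight (R.leftOp x σ)ᴴ := if_neg h

variable {R} in
theorem doubledOp_conjTranspose_of_left {x : X} (h : R.left x) (σ : Fin 2) :
    (R.doubledOp x σ)ᴴ = oddLeft (R.leftOp x σ)ᴴ := by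
  rw [doubledOp_of_left h, oddLeft_conjTranspose (R.isOdd_leftOp x σ)]

variable {R} in
theorem doubledOp_conjTranspose_of_not_left {x : X} (h : ¬ R.left x) (σ : Fin 2) :
    (R.doubledOp x σ)ᴴ = (R.sign x : ℂ) • oddRight (R.leftOp x σ) := by
  rw [doubledOp_of_not_left h, Matrix.conjTranspose_smul, oddRight_conjTranspose,
    Matrix.conjTranspose_conjTranspose, RCLike.star_def, Complex.conj_ofReal]

theorem isCAR_doubledOp : IsCAR fun p : X × Fin 2 => R.doubledOp p.1 p.2 := by
  have hodd := R.isOdd_leftOp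
  have hodd' := fun x σ => (R.isOdd_leftOp x σ).conjTranspose
  have hcar := isCAR_annihilate (Fintype.equivFin R.LeftMode)
  have hanti : ∀ x σ y τ, R.leftOp x σ * R.leftOp y τ + R.leftOp y τ * R.leftOp x σ = 0 :=
    fun x σ y τ => hcar.anti _ _
  have hmixed : ∀ x σ y τ, (R.left x ↔ R.left y) →
      R.leftOp x σ * (R.leftOp y τ)ᴴ + (R.leftOp y τ)ᴴ * R.leftOp x σ =
        if (x, σ) = (y, τ) then 1 else 0 := by
    intro x σ y τ h
    refine (hcar.mixed _ _).trans ?_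
    simp only [Prod.mk.injEq, R.fold_eq_fold h]
  constructor
  · rintro ⟨x, σ⟩ ⟨y, τ⟩
    by_cases hx : R.left x <;> by_cases hy : R.left y
    · simp only [doubledOp_of_left hx, doubledOp_of_left hy,
        oddLeft_mul_oddLeft _ (hodd _ _), ← map_add, hanti, map_zero]
    · simp only [doubledOp_of_left hx, doubledOp_of_not_left hy, mul_smul_comm, smul_mul_assoc,
        oddLeft_mul_oddRight, oddRight_mul_oddLeft (hodd _ _), smul_neg, add_neg_cancel]
    · simp only [doubledOp_of_left hy, doubledOp_of_not_left hx, mul_smul_comm, smul_mul_assoc,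
        oddLeft_mul_oddRight, oddRight_mul_oddLeft (hodd _ _), smul_neg, neg_add_cancel]
    · simp only [doubledOp_of_not_left hx, doubledOp_of_not_left hy, smul_mul_smul_comm,
        oddRight_mul_oddRight]
      rw [mul_comm (R.sign y : ℂ), ← smul_add, ← map_add, ← Matrix.conjTranspose_mul,
        ← Matrix.conjTranspose_mul, ← Matrix.conjTranspose_add, hanti]
      simp
  · rintro ⟨x, σ⟩ ⟨y, τ⟩
    by_cases hx : R.left x <;> by_cases hy : R.left y
    · simp only [doubledOp_of_left hx, doubledOp_conjTranspose_of_left hy,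
        oddLeft_mul_oddLeft _ (hodd _ _), oddLeft_mul_oddLeft _ (hodd' _ _), ← map_add,
        hmixed x σ y τ (by tauto)]
      split_ifs <;> simp
    · have : ¬ ((x, σ) = (y, τ)) := fun h => hy ((Prod.mk.inj h).1 ▸ hx)
      simp only [doubledOp_of_left hx, doubledOp_conjTranspose_of_not_left hy, mul_smul_comm,
        smul_mul_assoc, oddLeft_mul_oddRight, oddRight_mul_oddLeft (hodd _ _), smul_neg,
        add_neg_cancel, if_neg this]
    · have : ¬ ((x, σ) = (y, τ)) := fun h => hx ((Prod.mk.inj h).1 ▸ hy)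
      simp only [doubledOp_conjTranspose_of_left hy, doubledOp_of_not_left hx, mul_smul_comm,
        smul_mul_assoc, oddLeft_mul_oddRight, oddRight_mul_oddLeft (hodd' _ _), smul_neg,
        neg_add_cancel, if_neg this]
    · simp only [doubledOp_of_not_left hx, doubledOp_conjTranspose_of_not_left hy,
        smul_mul_smul_comm, oddRight_mul_oddRight]
      rw [mul_comm (R.sign y : ℂ), ← smul_add, ← map_add, add_comm, hmixed y τ x σ (by tauto),
        ← Complex.ofReal_mul]
      simp only [eq_comm (a := (y, τ))]
      split_ifs with h
      · obtain ⟨rfl, -⟩ := Prod.mk.inj h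
        rw [R.sign_mul_self]
        simp
      · simp

/-! ### The Hamiltonian in the doubled representation -/

section

variable {R}

theorem hopOp_doubledOp_left {x y : X} (hx : R.left x) (hy : R.left y) :
    hopOp R.doubledOp x y = inl (hopOp R.leftOp x y) := by
  simp only [hopOp, doubledOp_of_left hx, doubledOp_of_left hy,
    oddLeft_conjTranspose (R.isOdd_leftOp _ _), oddLeft_mul_oddLeft _ (R.isOdd_leftOp _ _),
    map_sum, map_sub]

theorem hopOp_doubledOp_right {x y : X} (hx : ¬ R.left x) (hy : ¬ R.left y) :
    hopOp R.doubledOp x y = ((R.sign x * R.sign y : ℝ) : ℂ) • inr (hopOp R.leftOp x y) := by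
  have hcar := isCAR_annihilate (Fintype.equivFin R.LeftMode)
  have key : ∀ σ, R.leftOp x σ * (R.leftOp y σ)ᴴ - R.leftOp y σ * (R.leftOp x σ)ᴴ =
      (R.leftOp x σ)ᴴ * R.leftOp y σ - (R.leftOp y σ)ᴴ * R.leftOp x σ := by
    intro σ
    have h1 := hcar.mixed (R.fold x, σ) (R.fold y, σ)
    have h2 := hcar.mixed (R.fold y, σ) (R.fold x, σ)
    simp only [eq_comm (a := (R.fold y, σ))] at h2
    have h3 := h1.trans h2.symm
    rw [sub_eq_sub_iff_add_eq_add]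
    refine h3.trans ?_
    exact add_comm _ _
  simp only [hopOp, doubledOp_of_not_left hx, doubledOp_of_not_left hy,
    Matrix.conjTranspose_smul, oddRight_conjTranspose,
    Matrix.conjTranspose_conjTranspose, RCLike.star_def, Complex.conj_ofReal,
    smul_mul_smul_comm, oddRight_mul_oddRight, map_sum, Finset.smul_sum, ← key]
  refine Finset.sum_congr rfl fun σ _ => ?_
  rw [mul_comm (R.sign y : ℂ), ← smul_sub, ← map_sub, Complex.ofReal_mul]

theorem hopOp_doubledOp_crossing {x y : X} (hx : R.left x) (hy : ¬ R.left y) :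
    hopOp R.doubledOp x y = (I * (R.sign y : ℂ)) • ∑ σ,
      (inl (R.leftOp x σ)ᴴ * inr (R.leftOp y σ)ᴴ + inl (R.leftOp x σ) * inr (R.leftOp y σ)) := by
  simp only [hopOp, doubledOp_of_left hx, doubledOp_of_not_left hy,
    oddLeft_conjTranspose (R.isOdd_leftOp _ _), Matrix.conjTranspose_smul, oddRight_conjTranspose,
    Matrix.conjTranspose_conjTranspose, RCLike.star_def, Complex.conj_ofReal,
    mul_smul_comm, smul_mul_assoc, oddLeft_mul_oddRight,
    oddRight_mul_oddLeft (R.isOdd_leftOp _ _), Finset.smul_sum, smul_neg, sub_neg_eq_add,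
    smul_smul, smul_add, mul_comm I]

theorem pair₁_doubledOp_left {x : X} (hx : R.left x) :
    pair₁ R.doubledOp x = inl (pair₁ R.leftOp x) := by
  simp only [pair₁, doubledOp_of_left hx, oddLeft_conjTranspose (R.isOdd_leftOp _ _),
    oddLeft_mul_oddLeft _ (R.isOdd_leftOp _ _),
    oddLeft_mul_oddLeft _ (R.isOdd_leftOp _ _).conjTranspose, map_add]

theorem pair₂_doubledOp_left {x : X} (hx : R.left x) :
    pair₂ R.doubledOp x = inl (pair₂ R.leftOp x) := by
  simp only [pair₂, doubledOp_of_left hx, oddLeft_conjTranspose (R.isOdd_leftOp _ _),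
    oddLeft_mul_oddLeft _ (R.isOdd_leftOp _ _),
    oddLeft_mul_oddLeft _ (R.isOdd_leftOp _ _).conjTranspose, map_sub, map_smul]

theorem leftOp_mul_leftOp (x : X) :
    R.leftOp x 0 * R.leftOp x 1 = -(R.leftOp x 1 * R.leftOp x 0) :=
  eq_neg_of_add_eq_zero_left ((isCAR_annihilate (Fintype.equivFin R.LeftMode)).anti _ _)

theorem leftOp_conjTranspose_mul (x : X) :
    (R.leftOp x 1)ᴴ * (R.leftOp x 0)ᴴ = -((R.leftOp x 0)ᴴ * (R.leftOp x 1)ᴴ) := by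
  rw [← Matrix.conjTranspose_mul, ← Matrix.conjTranspose_mul, leftOp_mul_leftOp,
    Matrix.conjTranspose_neg]

theorem pair₁_doubledOp_right {x : X} (hx : ¬ R.left x) :
    pair₁ R.doubledOp x = -inr (pair₁ R.leftOp x) := by
  simp only [pair₁, doubledOp_of_not_left hx, Matrix.conjTranspose_smul, oddRight_conjTranspose,
    Matrix.conjTranspose_conjTranspose, RCLike.star_def, Complex.conj_ofReal,
    smul_mul_smul_comm, oddRight_mul_oddRight, ← Complex.ofReal_mul, R.sign_mul_self,
    leftOp_mul_leftOp, leftOp_conjTranspose_mul, map_add, map_neg, Complex.ofReal_one, one_smul]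
  abel

theorem pair₂_doubledOp_right {x : X} (hx : ¬ R.left x) :
    pair₂ R.doubledOp x = inr (pair₂ R.leftOp x) := by
  simp only [pair₂, doubledOp_of_not_left hx, Matrix.conjTranspose_smul, oddRight_conjTranspose,
    Matrix.conjTranspose_conjTranspose, RCLike.star_def, Complex.conj_ofReal,
    smul_mul_smul_comm, oddRight_mul_oddRight, ← Complex.ofReal_mul, R.sign_mul_self,
    leftOp_mul_leftOp, leftOp_conjTranspose_mul, map_sub, map_neg, map_smul, Complex.ofReal_one,
    one_smul]
  congr 1
  abel

theorem conjM_leftOp_conjTranspose (x : X) (σ : Fin 2) :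
    conjM (R.leftOp x σ)ᴴ = (R.leftOp x σ)ᴴ := by
  rw [conjM_conjTranspose, conjM_leftOp]

theorem conjM_hopOp (x y : X) : conjM (hopOp R.leftOp x y) = hopOp R.leftOp x y := by
  simp only [hopOp, map_sum, map_sub, map_mul, conjM_leftOp_conjTranspose, conjM_leftOp]

theorem conjM_pair₁ (x : X) : conjM (pair₁ R.leftOp x) = pair₁ R.leftOp x := by
  simp only [pair₁, map_add, map_mul, conjM_leftOp_conjTranspose, conjM_leftOp]

theorem conjM_pair₂ (x : X) : conjM (pair₂ R.leftOp x) = -pair₂ R.leftOp x := by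
  simp only [pair₂, conjM_smul, map_sub, map_mul, conjM_leftOp_conjTranspose, conjM_leftOp,
    RCLike.star_def, Complex.conj_I, neg_smul]

end

end BondSystem.Reflection

namespace BondSystem.Reflection

variable {X E : Type*} {G : BondSystem X E} (R : G.Reflection)

theorem left_src_reflBond_iff (b : E) :
    (R.left (G.src (R.reflBond b)) ∧ R.left (G.tgt (R.reflBond b))) ↔
      (¬ R.left (G.src b) ∧ ¬ R.left (G.tgt b)) := by
  rcases R.bond b with ⟨h1, h2, -⟩ | ⟨h1, h2, -⟩ <;> rw [h1, h2, R.left_refl, R.left_refl]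
  exact and_comm

theorem sum_refl [Fintype X] {M : Type*} [AddCommMonoid M] (f : X → M) :
    ∑ x, f (R.refl x) = ∑ x, f x :=
  Equiv.sum_comp ⟨R.refl, R.refl, R.refl_refl, R.refl_refl⟩ f

theorem sum_reflBond [Fintype E] {M : Type*} [AddCommMonoid M] (f : E → M) :
    ∑ b, f (R.reflBond b) = ∑ b, f b :=
  Equiv.sum_comp ⟨R.reflBond, R.reflBond, R.reflBond_reflBond, R.reflBond_reflBond⟩ f

variable [DecidablePred R.left]

/-- The values on the bonds that equal `u` on the left half, the mirror image of `v` up to a sign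
on the right half, and `u - v` on the bonds between the halves. -/
def join (u v : E → ℝ) (b : E) : ℝ :=
  if R.left (G.src b) ∧ R.left (G.tgt b) then u b
  else if ¬ R.left (G.src b) ∧ ¬ R.left (G.tgt b) then -v (R.reflBond b) else u b - v b

variable [Fintype X] [DecidableEq X]

/-- The operators on the left half contributed by the bond `b`. -/
def leftBond (k : ℝ) (b : E) : FockOp R.LeftMode :=
  if R.left (G.src b) ∧ R.left (G.tgt b) then G.bondTerm R.leftOp k b
  else if ¬ R.left (G.src b) ∧ ¬ R.left (G.tgt b) then 0
  else ((G.coupling / 4 : ℝ) : ℂ) •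
    ((pair₁ R.leftOp (G.src b) + (k : ℂ) • 1) ^ 2 - pair₂ R.leftOp (G.src b) ^ 2)

/-- The Hamiltonian of the left half. -/
def leftEnergy [Fintype E] (k : E → ℝ) : FockOp R.LeftMode :=
  ∑ b, R.leftBond (k b) b + ∑ x, if R.left x then G.siteTerm R.leftOp x else 0

/-- The absolute value of the hopping amplitude of a bond between the two halves. -/
def crossAmp (b : E) : ℝ :=
  if R.left (G.src b) then G.amp b * R.sign (G.tgt b) else -(G.amp b * R.sign (G.src b))

/-- The coupling of the two halves by the bond `b`. -/
def crossBond (k k' : ℝ) (b : E) :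
    Matrix (Finset R.LeftMode × Finset R.LeftMode) (Finset R.LeftMode × Finset R.LeftMode) ℂ :=
  if (R.left (G.src b) ↔ R.left (G.tgt b)) then 0
  else ((G.coupling / 2 : ℝ) : ℂ) •
      (inl (pair₁ R.leftOp (G.src b) + (k : ℂ) • 1) *
          inr (conjM (pair₁ R.leftOp (G.src b) + (k' : ℂ) • 1)) +
        inl (pair₂ R.leftOp (G.src b)) * inr (conjM (pair₂ R.leftOp (G.src b)))) +
    (R.crossAmp b : ℂ) • ∑ σ,
      (inl (R.leftOp (G.src b) σ)ᴴ * inr (conjM (R.leftOp (G.src b) σ)ᴴ) +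
        inl (R.leftOp (G.src b) σ) * inr (conjM (R.leftOp (G.src b) σ)))

variable {R}

theorem schwarzTriple_crossBond (hg : 0 ≤ G.coupling) (k k' : ℝ) (b : E) :
    SchwarzTriple (R.crossBond k k b) (R.crossBond k k' b) (R.crossBond k' k' b) := by
  by_cases h : R.left (G.src b) ↔ R.left (G.tgt b)
  · simp only [crossBond, if_pos h]
    exact SchwarzTriple.zero
  have hamp : 0 ≤ R.crossAmp b := by
    unfold crossAmp
    split_ifs with h1
    · exact (R.crossing_left b h1 (by tauto)).2
    · exact neg_nonneg.2 (R.crossing_right b h1 (by tauto)).2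
  simp only [crossBond, if_neg h]
  exact (((SchwarzTriple.of_pair _ _).add (SchwarzTriple.of_pair _ _)).smul (by positivity)).add
    ((SchwarzTriple.sum _ fun σ _ =>
      (SchwarzTriple.of_pair _ _).add (SchwarzTriple.of_pair _ _)).smul hamp)

theorem siteTerm_doubledOp_left {x : X} (hx : R.left x) :
    G.siteTerm R.doubledOp x = inl (G.siteTerm R.leftOp x) := by
  simp only [siteTerm, pair₁_doubledOp_left hx, pair₂_doubledOp_left hx, map_sub, map_neg,
    map_smul, map_pow]

theorem siteTerm_doubledOp_refl {x : X} (hx : R.left x) :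
    G.siteTerm R.doubledOp (R.refl x) = inr (conjM (G.siteTerm R.leftOp x)) := by
  have hx' : ¬ R.left (R.refl x) := fun h => (R.left_refl x).1 h hx
  have e1 : pair₁ R.leftOp (R.refl x) = pair₁ R.leftOp x := by simp only [pair₁, leftOp_refl]
  have e2 : pair₂ R.leftOp (R.refl x) = pair₂ R.leftOp x := by simp only [pair₂, leftOp_refl]
  simp only [siteTerm, pair₁_doubledOp_right hx', pair₂_doubledOp_right hx', map_sub, map_neg,
    map_smul, map_pow, conjM_smul, conjM_pair₁, conjM_pair₂, R.field_refl, e1, e2,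
    RCLike.star_def, Complex.conj_ofReal, Complex.ofReal_neg, neg_sq, smul_neg, neg_smul]

theorem bondTerm_doubledOp_left {b : E} (hs : R.left (G.src b)) (ht : R.left (G.tgt b)) (k : ℝ) :
    G.bondTerm R.doubledOp k b = inl (G.bondTerm R.leftOp k b) := by
  simp only [bondTerm, pair₁_doubledOp_left hs, pair₂_doubledOp_left hs, pair₁_doubledOp_left ht,
    pair₂_doubledOp_left ht, hopOp_doubledOp_left hs ht, map_add, map_sub, map_smul, map_pow,
    map_one]

theorem bondTerm_doubledOp_reflBond {b : E} (hs : R.left (G.src b)) (ht : R.left (G.tgt b))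
    (k : ℝ) : G.bondTerm R.doubledOp (-k) (R.reflBond b) =
      inr (conjM (G.bondTerm R.leftOp k b)) := by
  have hs' : ¬ R.left (R.refl (G.src b)) := fun h => (R.left_refl _).1 h hs
  have ht' : ¬ R.left (R.refl (G.tgt b)) := fun h => (R.left_refl _).1 h ht
  have e1 : ∀ x, pair₁ R.leftOp (R.refl x) = pair₁ R.leftOp x := fun x => by
    simp only [pair₁, leftOp_refl]
  have e2 : ∀ x, pair₂ R.leftOp (R.refl x) = pair₂ R.leftOp x := fun x => by
    simp only [pair₂, leftOp_refl]
  have e3 : ∀ x y, hopOp R.leftOp (R.refl x) (R.refl y) = hopOp R.leftOp x y := fun x y => by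
    simp only [hopOp, leftOp_refl]
  have hsq : ∀ A B : FockOp R.LeftMode, (-inr A + -inr B + ((-k : ℝ) : ℂ) • 1) ^ 2 =
      (inr A + inr B + (k : ℂ) • 1) ^ 2 := by
    intro A B
    rw [← neg_sq]
    congr 1
    rw [Complex.ofReal_neg, neg_smul]
    abel
  have hsq' : ∀ A B : FockOp R.LeftMode, (-inr A - -inr B) ^ 2 = (inr A - inr B) ^ 2 := by
    intro A B
    rw [neg_sub_neg, ← neg_sub, neg_sq]
  simp only [bondTerm, map_add, map_sub, map_smul, map_pow, map_one, conjM_smul, conjM_pair₁,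
    conjM_pair₂, conjM_hopOp, RCLike.star_def, map_mul, Complex.conj_I, Complex.conj_ofReal]
  rcases R.bond b with ⟨h1, h2, h3⟩ | ⟨h1, h2, h3⟩
  · have hamp : I * (G.amp (R.reflBond b) : ℂ) *
        ((R.sign (R.refl (G.src b)) * R.sign (R.refl (G.tgt b)) : ℝ) : ℂ) =
        -I * (G.amp b : ℂ) := by
      rw [mul_assoc, ← Complex.ofReal_mul, h3]
      push_cast; ring
    simp only [h1, h2, pair₁_doubledOp_right hs', pair₁_doubledOp_right ht',
      pair₂_doubledOp_right hs', pair₂_doubledOp_right ht', hopOp_doubledOp_right hs' ht', e1, e2,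
      e3, hsq, smul_smul, map_neg, hsq', hamp]
  · have hamp : I * (G.amp (R.reflBond b) : ℂ) *
        ((R.sign (R.refl (G.tgt b)) * R.sign (R.refl (G.src b)) : ℝ) : ℂ) =
        I * (G.amp b : ℂ) := by
      rw [mul_assoc, ← Complex.ofReal_mul, mul_comm (R.sign _), h3 ⟨fun _ => ht, fun _ => hs⟩]
    simp only [h1, h2, pair₁_doubledOp_right hs', pair₁_doubledOp_right ht',
      pair₂_doubledOp_right hs', pair₂_doubledOp_right ht', hopOp_doubledOp_right ht' hs', e1, e2,
      e3, hsq, smul_smul, map_neg, hsq', hamp]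
    rw [hopOp_swap R.leftOp (G.src b), map_neg, smul_neg, ← neg_smul, ← neg_mul,
      add_comm (inr (pair₁ R.leftOp (G.tgt b))), ← neg_sub (inr (pair₂ R.leftOp (G.src b))),
      neg_sq]

theorem bondTerm_doubledOp_crossing {b : E} (h : ¬ (R.left (G.src b) ↔ R.left (G.tgt b)))
    (k k' : ℝ) : G.bondTerm R.doubledOp (k - k') b =
      inl (R.leftBond k b) + inr (conjM (R.leftBond k' b)) - R.crossBond k k' b := by
  have h1 : ¬ (R.left (G.src b) ∧ R.left (G.tgt b)) := by tauto
  have h2 : ¬ (¬ R.left (G.src b) ∧ ¬ R.left (G.tgt b)) := by tauto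
  -- The bond joins a site to its mirror image, with the same operators on the left half.
  have hop : (I * (G.amp b : ℂ)) • hopOp R.doubledOp (G.src b) (G.tgt b) =
        -((R.crossAmp b : ℂ) • ∑ σ,
          (inl (R.leftOp (G.src b) σ)ᴴ * inr (R.leftOp (G.src b) σ)ᴴ +
            inl (R.leftOp (G.src b) σ) * inr (R.leftOp (G.src b) σ))) ∧
        pair₁ R.doubledOp (G.src b) + pair₁ R.doubledOp (G.tgt b) =
          inl (pair₁ R.leftOp (G.src b)) - inr (pair₁ R.leftOp (G.src b)) ∧
        (pair₂ R.doubledOp (G.src b) - pair₂ R.doubledOp (G.tgt b)) ^ 2 =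
          (inl (pair₂ R.leftOp (G.src b)) - inr (pair₂ R.leftOp (G.src b))) ^ 2 := by
    by_cases hs : R.left (G.src b)
    · have ht : ¬ R.left (G.tgt b) := by tauto
      have hrefl := (R.crossing_left b hs ht).1
      have e : R.leftOp (G.tgt b) = R.leftOp (G.src b) := by rw [hrefl, leftOp_refl]
      refine ⟨?_, ?_, ?_⟩
      · rw [hopOp_doubledOp_crossing hs ht, e, smul_smul, crossAmp, if_pos hs, ← neg_smul]
        congr 1
        push_cast
        linear_combination (G.amp b : ℂ) * (R.sign (G.tgt b) : ℂ) * Complex.I_mul_I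
      · rw [pair₁_doubledOp_left hs, pair₁_doubledOp_right ht, ← sub_eq_add_neg]
        simp only [pair₁, e]
      · rw [pair₂_doubledOp_left hs, pair₂_doubledOp_right ht]
        simp only [pair₂, e]
    · have ht : R.left (G.tgt b) := by tauto
      have hrefl := (R.crossing_right b hs ht).1
      have e : R.leftOp (G.tgt b) = R.leftOp (G.src b) := by rw [hrefl, leftOp_refl]
      refine ⟨?_, ?_, ?_⟩
      · rw [hopOp_swap, hopOp_doubledOp_crossing ht hs, e, smul_neg, smul_smul,
          crossAmp, if_neg hs]
        congr 2
        push_cast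
        linear_combination (G.amp b : ℂ) * (R.sign (G.src b) : ℂ) * Complex.I_mul_I
      · rw [pair₁_doubledOp_left ht, pair₁_doubledOp_right hs, neg_add_eq_sub]
        simp only [pair₁, e]
      · rw [pair₂_doubledOp_left ht, pair₂_doubledOp_right hs, ← neg_sq, neg_sub]
        simp only [pair₂, e]
  obtain ⟨hop, e1, e2⟩ := hop
  have hk : (((k - k' : ℝ)) : ℂ) = k - k' := by push_cast; rfl
  simp only [bondTerm, hop, e1, e2, crossBond, leftBond, if_neg h, if_neg h1, if_neg h2, hk,
    conjM_leftOp_conjTranspose, conjM_leftOp, conjM_pair₁, conjM_pair₂, conjM_smul, map_add,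
    map_sub, map_smul, map_pow, map_one, RCLike.star_def, Complex.conj_ofReal, map_neg, neg_sq]
  have c1 := inr_mul_inl (pair₁ R.leftOp (G.src b)) (pair₁ R.leftOp (G.src b))
  have c2 := inr_mul_inl (pair₂ R.leftOp (G.src b)) (pair₂ R.leftOp (G.src b))
  generalize inl (pair₁ R.leftOp (G.src b)) = p at *
  generalize inr (pair₁ R.leftOp (G.src b)) = q at *
  generalize inl (pair₂ R.leftOp (G.src b)) = p' at *
  generalize inr (pair₂ R.leftOp (G.src b)) = q' at *
  have s1 : (p - q + ((k : ℂ) - k') • 1) ^ 2 = (p + (k : ℂ) • 1) ^ 2 + (q + (k' : ℂ) • 1) ^ 2 -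
      (2 : ℂ) • ((p + (k : ℂ) • 1) * (q + (k' : ℂ) • 1)) := by
    have c3 : (q + (k' : ℂ) • 1) * (p + (k : ℂ) • 1) = (p + (k : ℂ) • 1) * (q + (k' : ℂ) • 1) := by
      simp only [mul_add, add_mul, c1, mul_smul_comm, smul_mul_assoc, mul_one, one_mul]
      module
    have : p - q + ((k : ℂ) - k') • (1 : Matrix (Finset R.LeftMode × Finset R.LeftMode)
        (Finset R.LeftMode × Finset R.LeftMode) ℂ) =
        (p + (k : ℂ) • 1) - (q + (k' : ℂ) • 1) := by
      rw [sub_smul]; abel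
    rw [this, sq, sub_mul, mul_sub, mul_sub, c3, two_smul, sq, sq]
    abel
  have s2 : (p' - q') ^ 2 = p' ^ 2 + q' ^ 2 - (2 : ℂ) • (p' * q') := by
    rw [sq, sub_mul, mul_sub, mul_sub, c2, two_smul, sq, sq]
    abel
  rw [s1, s2, mul_neg]
  have hg : ((G.coupling / 2 : ℝ) : ℂ) = ((G.coupling / 4 : ℝ) : ℂ) * 2 := by push_cast; ring
  rw [hg]
  module

variable [Fintype E]

variable (R) in
/-- The Hamiltonian splits into the Hamiltonians of the two halves and the couplings of the bonds
between them. -/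
theorem energy_doubledOp (u v : E → ℝ) : G.energy R.doubledOp (R.join u v) =
    inl (R.leftEnergy u) + inr (conjM (R.leftEnergy v)) - ∑ b, R.crossBond (u b) (v b) b := by
  have hsite : ∑ x, G.siteTerm R.doubledOp x =
      inl (∑ x, if R.left x then G.siteTerm R.leftOp x else 0) +
        inr (conjM (∑ x, if R.left x then G.siteTerm R.leftOp x else 0)) := by
    have h1 : ∀ x, G.siteTerm R.doubledOp x =
        (if R.left x then G.siteTerm R.doubledOp x else 0) +
          (if R.left (R.refl x) then G.siteTerm R.doubledOp x else 0) := by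
      intro x
      by_cases h : R.left x <;> simp [R.left_refl, h]
    rw [Finset.sum_congr rfl fun x _ => h1 x, Finset.sum_add_distrib,
      ← R.sum_refl fun x => if R.left (R.refl x) then G.siteTerm R.doubledOp x else 0]
    simp only [R.refl_refl, map_sum]
    congr 1 <;> refine Finset.sum_congr rfl fun x _ => ?_ <;> split_ifs with h
    · exact siteTerm_doubledOp_left h
    · simp
    · exact siteTerm_doubledOp_refl h
    · simp
  have hbond : ∑ b, G.bondTerm R.doubledOp (R.join u v b) b =
      ∑ b, (inl (R.leftBond (u b) b) + inr (conjM (R.leftBond (v b) b)) -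
        R.crossBond (u b) (v b) b) := by
    let T b := G.bondTerm R.doubledOp (R.join u v b) b
    have h1 : ∀ b, T b = (if ¬ R.left (G.src b) ∧ ¬ R.left (G.tgt b) then 0 else T b) +
          (if R.left (G.src (R.reflBond b)) ∧ R.left (G.tgt (R.reflBond b)) then T b else 0) := by
      intro b
      rw [if_congr (R.left_src_reflBond_iff b) rfl rfl]
      split_ifs <;> simp
    change ∑ b, T b = _
    rw [Finset.sum_congr rfl fun b _ => h1 b, Finset.sum_add_distrib,
      ← R.sum_reflBond fun b =>
        if R.left (G.src (R.reflBond b)) ∧ R.left (G.tgt (R.reflBond b)) then T b else 0,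
      ← Finset.sum_add_distrib]
    simp only [R.reflBond_reflBond]
    refine Finset.sum_congr rfl fun b _ => ?_
    by_cases hLL : R.left (G.src b) ∧ R.left (G.tgt b)
    · have hRR : ¬ R.left (G.src (R.reflBond b)) ∧ ¬ R.left (G.tgt (R.reflBond b)) := by
        rw [← R.left_src_reflBond_iff, R.reflBond_reflBond]; exact hLL
      have hLL' : ¬ (R.left (G.src (R.reflBond b)) ∧ R.left (G.tgt (R.reflBond b))) :=
        fun h => hRR.1 h.1
      rw [if_neg (fun h => h.1 hLL.1), if_pos hLL]
      simp only [T, join, leftBond, crossBond, if_pos hLL, if_pos hRR, if_neg hLL',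
        if_pos (iff_of_true hLL.1 hLL.2), R.reflBond_reflBond]
      rw [bondTerm_doubledOp_left hLL.1 hLL.2, bondTerm_doubledOp_reflBond hLL.1 hLL.2, sub_zero]
    by_cases hRR : ¬ R.left (G.src b) ∧ ¬ R.left (G.tgt b)
    · rw [if_pos hRR, if_neg hLL]
      simp only [leftBond, crossBond, if_pos hRR, if_neg hLL, if_pos (iff_of_false hRR.1 hRR.2)]
      simp
    · rw [if_neg hRR, if_neg hLL, add_zero, ← bondTerm_doubledOp_crossing (by tauto)]
      simp only [T, join, if_neg hLL, if_neg hRR]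
  rw [energy, hsite, hbond, Finset.sum_sub_distrib, Finset.sum_add_distrib, leftEnergy, leftEnergy]
  simp only [map_add, map_sum]
  abel

variable (R) in
/-- Reflection positivity of the partition function. -/
theorem norm_partitionFunction_join_sq_le {n : ℕ} (e : X × Fin 2 ≃ Fin n)
    (hg : 0 ≤ G.coupling) {β : ℝ} (hβ : 0 ≤ β) (u v : E → ℝ) :
    ‖G.partitionFunction (fun x σ => annihilate e (x, σ)) β (R.join u v)‖ ^ 2 ≤
      ‖G.partitionFunction (fun x σ => annihilate e (x, σ)) β (R.join u u)‖ *
        ‖G.partitionFunction (fun x σ => annihilate e (x, σ)) β (R.join v v)‖ := by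
  obtain ⟨φ, hφ, htr⟩ := R.isCAR_doubledOp.exists_starAlgHom e R.card_doubled
  have key : ∀ u v, G.partitionFunction (fun x σ => annihilate e (x, σ)) β (R.join u v) =
      (NormedSpace.exp (inl (-(β : ℂ) • R.leftEnergy u) +
        inr (conjM (-(β : ℂ) • R.leftEnergy v)) +
          (β : ℂ) • ∑ b, R.crossBond (u b) (v b) b)).trace := by
    intro u v
    rw [partitionFunction, ← htr, map_smul, map_energy]
    simp only [hφ]
    rw [energy_doubledOp, conjM_smul, map_smul, map_smul, star_neg, RCLike.star_def,
      Complex.conj_ofReal, smul_sub, smul_add, neg_smul, neg_smul, neg_smul, sub_neg_eq_add]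
  rw [key, key, key]
  exact norm_trace_exp_sq_le _ _
    ((SchwarzTriple.sum _ fun b _ => schwarzTriple_crossBond hg _ _ b).smul hβ)

end BondSystem.Reflection

/-! ### Gaussian domination from reflections -/

namespace BondSystem

variable {X E : Type*} [Fintype E] (G : BondSystem X E)

open Classical in
/-- A function of the numbers on the bonds is largest at `0` if it satisfies the Schwarz inequality
for sufficiently many reflections. Among the maximizers, one with the fewest nonzero values has
none at all, for otherwise a reflection would yield a maximizer with fewer nonzero values. -/
theorem le_apply_zero_of_reflections {f : (E → ℝ) → ℝ} (hf : ∀ k, 0 ≤ f k)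
    (hR : ∀ b, ∃ R : G.Reflection, ¬ (R.left (G.src b) ↔ R.left (G.tgt b)) ∧
      ∀ u v, f (R.join u v) ^ 2 ≤ f (R.join u u) * f (R.join v v)) (k₀ : E → ℝ) :
    f k₀ ≤ f 0 := by
  -- Reflections only permute the values, change their signs and replace some of them by `0`, so
  -- it suffices to maximize over functions with values in a finite set.
  obtain ⟨V, hV0, hVneg, hVk⟩ : ∃ V : Finset ℝ, 0 ∈ V ∧ (∀ r ∈ V, -r ∈ V) ∧ ∀ b, k₀ b ∈ V := by
    refine ⟨insert 0 (Finset.univ.image k₀ ∪ Finset.univ.image fun b => -k₀ b),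
      Finset.mem_insert_self _ _, fun r hr => ?_, fun b => by simp⟩
    simp only [Finset.mem_insert, Finset.mem_union, Finset.mem_image, Finset.mem_univ,
      true_and] at hr ⊢
    rcases hr with rfl | ⟨b, rfl⟩ | ⟨b, rfl⟩
    · simp
    · exact Or.inr (Or.inr ⟨b, rfl⟩)
    · exact Or.inr (Or.inl ⟨b, by simp⟩)
  obtain ⟨S, hS⟩ : ∃ S : Finset (E → ℝ), ∀ k, k ∈ S ↔ ∀ b, k b ∈ V :=
    ⟨Fintype.piFinset fun _ => V, fun k => Fintype.mem_piFinset⟩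
  have hk₀ : k₀ ∈ S := (hS _).2 hVk
  obtain ⟨k₁, hk₁, hmax⟩ := S.exists_max_image f ⟨k₀, hk₀⟩
  let supp (k : E → ℝ) : ℕ := ∑ b, if k b = 0 then 0 else 1
  obtain ⟨k, hk, hmin⟩ := (S.filter fun k => f k = f k₁).exists_min_image supp
    ⟨k₁, Finset.mem_filter.2 ⟨hk₁, rfl⟩⟩
  obtain ⟨hkS, hkf⟩ := Finset.mem_filter.1 hk
  have hkV : ∀ b, k b ∈ V := (hS _).1 hkS
  rw [← hkf] at hmax hmin
  rcases (hf k).eq_or_lt with h0 | hpos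
  · exact (hmax k₀ hk₀).trans (h0.symm.le.trans (hf 0))
  suffices hk0 : k = 0 by
    rw [hk0] at hmax
    exact hmax k₀ hk₀
  by_contra hne
  obtain ⟨b₀, hb₀⟩ := Function.ne_iff.1 hne
  obtain ⟨R, hRb, hschwarz⟩ := hR b₀
  let v : E → ℝ := fun b =>
    if R.left (G.src b) ∧ R.left (G.tgt b) then -k (R.reflBond b) else 0
  have hswap : ∀ b, ¬ R.left (G.src b) ∧ ¬ R.left (G.tgt b) →
      R.left (G.src (R.reflBond b)) ∧ R.left (G.tgt (R.reflBond b)) :=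
    fun b => (R.left_src_reflBond_iff b).2
  have hjoin : R.join k v = k := by
    funext b
    simp only [Reflection.join]
    split_ifs with h1 h2
    · rfl
    · simp [v, if_pos (hswap b h2), R.reflBond_reflBond]
    · simp [v, if_neg h1]
  have hmem1 : R.join k k ∈ S := by
    refine (hS _).2 fun b => ?_
    simp only [Reflection.join, sub_self]
    split_ifs
    exacts [hkV _, hVneg _ (hkV _), hV0]
  have hmem2 : R.join v v ∈ S := by
    refine (hS _).2 fun b => ?_
    simp only [Reflection.join, sub_self]
    split_ifs with h1 h2
    · simp only [v, if_pos h1]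
      exact hVneg _ (hkV _)
    · simp only [v, if_pos (hswap b h2), R.reflBond_reflBond, neg_neg]
      exact hkV _
    · exact hV0
  have hRP : f k ^ 2 ≤ f (R.join k k) * f (R.join v v) := by
    have := hschwarz k v
    rwa [hjoin] at this
  have hle1 := hmax _ hmem1
  have hle2 := hmax _ hmem2
  have heq1 : f (R.join k k) = f k := by
    refine le_antisymm hle1 (le_of_mul_le_mul_right ?_ hpos)
    rw [← sq]
    exact hRP.trans (mul_le_mul_of_nonneg_left hle2 (hf _))
  have heq2 : f (R.join v v) = f k := by
    refine le_antisymm hle2 (le_of_mul_le_mul_left ?_ hpos)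
    rw [← sq]
    exact hRP.trans (mul_le_mul_of_nonneg_right hle1 (hf _))
  have hs1 := hmin _ (Finset.mem_filter.2 ⟨hmem1, heq1⟩)
  have hs2 := hmin _ (Finset.mem_filter.2 ⟨hmem2, heq2⟩)
  -- Together the two reflected functions have fewer nonzero values than two copies of `k`, since
  -- they vanish on the bonds between the halves.
  have hlt : supp (R.join k k) + supp (R.join v v) < supp k + supp k := by
    have h2 : supp k + supp k =
        ∑ b, ((if k b = 0 then 0 else 1) + (if k (R.reflBond b) = 0 then 0 else 1)) := by
      rw [Finset.sum_add_distrib, R.sum_reflBond fun b => if k b = 0 then 0 else 1]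
    rw [h2]
    simp only [supp]
    rw [← Finset.sum_add_distrib]
    refine Finset.sum_lt_sum (fun b _ => ?_) ⟨b₀, Finset.mem_univ _, ?_⟩
    · by_cases h1 : R.left (G.src b) ∧ R.left (G.tgt b)
      · simp [Reflection.join, if_pos h1, v]
      by_cases h2 : ¬ R.left (G.src b) ∧ ¬ R.left (G.tgt b)
      · simp only [Reflection.join, if_neg h1, if_pos h2, v, if_pos (hswap b h2),
          R.reflBond_reflBond, neg_neg, neg_eq_zero]
        exact (add_comm _ _).le
      · simp [Reflection.join, if_neg h1, if_neg h2]
    · have h1 : ¬ (R.left (G.src b₀) ∧ R.left (G.tgt b₀)) := by tauto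
      have h2 : ¬ (¬ R.left (G.src b₀) ∧ ¬ R.left (G.tgt b₀)) := by tauto
      have h3 : k b₀ ≠ 0 := hb₀
      simp [Reflection.join, if_neg h1, if_neg h2, h3]
  omega

/-- If every bond joins the two halves of some reflection, then the partition function is largest
when no numbers are added in the bond terms. -/
theorem norm_partitionFunction_le [Fintype X] [DecidableEq X] {n : ℕ} (e : X × Fin 2 ≃ Fin n)
    (hg : 0 ≤ G.coupling) {β : ℝ} (hβ : 0 ≤ β)
    (hR : ∀ b, ∃ R : G.Reflection, ¬ (R.left (G.src b) ↔ R.left (G.tgt b))) (k : E → ℝ) :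
    ‖G.partitionFunction (fun x σ => annihilate e (x, σ)) β k‖ ≤
      ‖G.partitionFunction (fun x σ => annihilate e (x, σ)) β 0‖ := by
  classical
  refine G.le_apply_zero_of_reflections
    (f := fun k => ‖G.partitionFunction (fun x σ => annihilate e (x, σ)) β k‖)
    (fun _ => norm_nonneg _) (fun b => ?_) k
  obtain ⟨R, h⟩ := hR b
  refine ⟨R, h, fun u v => ?_⟩
  convert R.norm_partitionFunction_join_sq_le e hg hβ u v

end BondSystem

/-! ### Reflections of the periodic lattice -/

namespace Coord

variable {L : ℕ}

theorem mem (u : Coord L) : 1 - (L : ℤ) ≤ u ∧ (u : ℤ) ≤ L := Finset.mem_Icc.1 u.2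

theorem coe_next (u : Coord L) :
    (u.next : ℤ) = if (u : ℤ) = L then 1 - (L : ℤ) else (u : ℤ) + 1 := by
  rw [next]
  split_ifs <;> rfl

/-- The representative of `u - c` modulo `2 L` in `{-L+1, …, L}`. -/
def rel (c u : Coord L) : ℤ :=
  if (L : ℤ) < u - c then u - c - 2 * L else if (u : ℤ) - c ≤ -L then u - c + 2 * L else u - c

/-- The reflection `u ↦ 2 c + 1 - u` modulo `2 L`, which exchanges `c` and `c + 1`. -/
def reflect (c u : Coord L) : Coord L :=
  ⟨if (L : ℤ) < 2 * c + 1 - u then 2 * c + 1 - u - 2 * L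
    else if 2 * (c : ℤ) + 1 - u ≤ -L then 2 * c + 1 - u + 2 * L else 2 * c + 1 - u, by
    have := c.mem
    have := u.mem
    rw [Finset.mem_Icc]
    split_ifs <;> omega⟩

theorem coe_reflect (c u : Coord L) : (c.reflect u : ℤ) =
    if (L : ℤ) < 2 * c + 1 - u then 2 * (c : ℤ) + 1 - u - 2 * L
    else if 2 * (c : ℤ) + 1 - u ≤ -L then 2 * (c : ℤ) + 1 - u + 2 * L
    else 2 * (c : ℤ) + 1 - u := rfl

theorem reflect_reflect (c u : Coord L) : c.reflect (c.reflect u) = u := by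
  have := c.mem
  have := u.mem
  ext
  rw [coe_reflect, coe_reflect]
  split_ifs <;> omega

theorem rel_reflect (c u : Coord L) : c.rel (c.reflect u) = 1 - c.rel u := by
  have := c.mem
  have := u.mem
  rw [rel, rel, coe_reflect]
  split_ifs <;> omega

theorem rel_mem (c u : Coord L) : 1 - (L : ℤ) ≤ c.rel u ∧ c.rel u ≤ L := by
  have := c.mem
  have := u.mem
  rw [rel]
  split_ifs <;> omega

theorem rel_next (c u : Coord L) :
    c.rel u.next = if c.rel u = L then 1 - (L : ℤ) else c.rel u + 1 := by
  have := c.mem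
  have := u.mem
  rw [rel, rel, coe_next]
  split_ifs <;> omega

theorem next_reflect_next (c u : Coord L) : (c.reflect u.next).next = c.reflect u := by
  have := c.mem
  have := u.mem
  ext
  rw [coe_next, coe_reflect, coe_reflect, coe_next]
  split_ifs <;> omega

theorem reflect_eq_next {c u : Coord L} (h : c.rel u = 0 ∨ c.rel u = L) :
    c.reflect u = u.next := by
  have := c.mem
  have := u.mem
  ext
  rw [coe_next, coe_reflect]
  rw [rel] at h
  split_ifs at h ⊢ <;> omega

/-- The sign that is `-1` on the coordinates that are reached from `c` only across the end of the
interval `{-L+1, …, L}`. As a gauge transformation, it moves the sign change of the hopping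
amplitude from the end of the interval to the bond opposite to `c`. -/
def windSign (c u : Coord L) : ℝ := if c.rel u = u - c then 1 else -1

theorem windSign_mul_self (c u : Coord L) : c.windSign u * c.windSign u = 1 := by
  rw [windSign]
  split_ifs <;> norm_num

/-- The sign of the antiperiodic boundary conditions. -/
def boundarySign (u : Coord L) : ℝ := if (u : ℤ) = L then -1 else 1

theorem boundarySign_of_ne {c u : Coord L} (h : c.rel u ≠ L) :
    u.boundarySign = c.windSign u * c.windSign u.next := by
  have := c.mem
  have := u.mem
  rw [boundarySign, windSign, windSign, rel_next, if_neg h, coe_next]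
  rw [rel] at *
  split_ifs at * <;> first | omega | norm_num

theorem boundarySign_of_eq {c u : Coord L} (h : c.rel u = L) :
    u.boundarySign = -(c.windSign u * c.windSign u.next) := by
  have := c.mem
  have := u.mem
  rw [boundarySign, windSign, windSign, rel_next, if_pos h, coe_next]
  rw [rel] at *
  split_ifs at * <;> first | omega | norm_num

theorem neg_one_zpow_next (u : Coord L) : (-1 : ℝ) ^ (u.next : ℤ) = -(-1 : ℝ) ^ (u : ℤ) := by
  have h : Odd ((u.next : ℤ) - u) := by
    rw [coe_next]
    split_ifs with h
    · exact ⟨-L, by omega⟩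
    · exact ⟨0, by omega⟩
  rw [← sub_add_cancel (u.next : ℤ) u, zpow_add₀ (by norm_num), h.neg_one_zpow, neg_one_mul]

theorem neg_one_zpow_reflect (c u : Coord L) :
    (-1 : ℝ) ^ (c.reflect u : ℤ) = -(-1 : ℝ) ^ (u : ℤ) := by
  have h : Odd ((c.reflect u : ℤ) - u) := by
    rw [coe_reflect]
    split_ifs with h h'
    · exact ⟨c - u - L, by omega⟩
    · exact ⟨c - u + L, by omega⟩
    · exact ⟨c - u, by omega⟩
  rw [← sub_add_cancel (c.reflect u : ℤ) u, zpow_add₀ (by norm_num), h.neg_one_zpow, neg_one_mul]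

end Coord

section Lattice

variable {d L : ℕ}

/-- The sign `(-1) ^ ∑ x_j`, the sum being over the directions `j ∈ s`. -/
def siteSign (s : Finset (Fin d)) (x : Site d L) : ℝ := ∏ j ∈ s, (-1 : ℝ) ^ (x j : ℤ)

theorem coe_siteSign (s : Finset (Fin d)) (x : Site d L) :
    (siteSign s x : ℂ) = (-1) ^ (∑ j ∈ s, (x j : ℤ)) := by
  induction s using Finset.induction_on with
  | empty => simp [siteSign]
  | insert j s hj ih =>
    rw [Finset.sum_insert hj, zpow_add₀ (by norm_num), ← ih, siteSign, siteSign,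
      Finset.prod_insert hj]
    push_cast; rfl

theorem siteSign_mul_self (s : Finset (Fin d)) (x : Site d L) :
    siteSign s x * siteSign s x = 1 := by
  rw [siteSign, ← Finset.prod_mul_distrib]
  refine Finset.prod_eq_one fun j _ => ?_
  rw [← mul_zpow]
  norm_num

theorem siteSign_update_of_notMem {s : Finset (Fin d)} {m : Fin d} (hm : m ∉ s) (x : Site d L)
    (u : Coord L) : siteSign s (Function.update x m u) = siteSign s x :=
  Finset.prod_congr rfl fun j hj => by
    rw [Function.update_of_ne (fun h : j = m => hm (h ▸ hj))]

theorem siteSign_update_of_mem {s : Finset (Fin d)} {m : Fin d} (hm : m ∈ s) {x : Site d L}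
    {u : Coord L} (h : (-1 : ℝ) ^ (u : ℤ) = -(-1 : ℝ) ^ (x m : ℤ)) :
    siteSign s (Function.update x m u) = -siteSign s x := by
  have h1 := siteSign_update_of_notMem (Finset.notMem_erase m s) x u
  rw [siteSign, siteSign] at h1
  rw [← Finset.insert_erase hm, siteSign, siteSign, Finset.prod_insert (Finset.notMem_erase _ _),
    Finset.prod_insert (Finset.notMem_erase _ _), h1, Function.update_self, h, neg_mul]

/-- The reflection of a site at the plane between the coordinates `c` and `c + 1` in the direction
`m`. -/
def reflectSite (m : Fin d) (c : Coord L) (x : Site d L) : Site d L :=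
  Function.update x m (c.reflect (x m))

theorem siteSign_shift_of_mem {s : Finset (Fin d)} {m : Fin d} (hm : m ∈ s) (x : Site d L) :
    siteSign s (shift m x) = -siteSign s x :=
  siteSign_update_of_mem hm (x m).neg_one_zpow_next

theorem siteSign_shift_of_notMem {s : Finset (Fin d)} {m : Fin d} (hm : m ∉ s) (x : Site d L) :
    siteSign s (shift m x) = siteSign s x :=
  siteSign_update_of_notMem hm _ _

theorem siteSign_reflectSite_of_mem {s : Finset (Fin d)} {m : Fin d} (hm : m ∈ s) (c : Coord L)
    (x : Site d L) : siteSign s (reflectSite m c x) = -siteSign s x :=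
  siteSign_update_of_mem hm (c.neg_one_zpow_reflect (x m))

theorem siteSign_reflectSite_of_notMem {s : Finset (Fin d)} {m : Fin d} (hm : m ∉ s) (c : Coord L)
    (x : Site d L) : siteSign s (reflectSite m c x) = siteSign s x :=
  siteSign_update_of_notMem hm _ _

theorem reflectSite_reflectSite (m : Fin d) (c : Coord L) (x : Site d L) :
    reflectSite m c (reflectSite m c x) = x := by
  simp [reflectSite, Coord.reflect_reflect]

theorem reflectSite_apply_self (m : Fin d) (c : Coord L) (x : Site d L) :
    reflectSite m c x m = c.reflect (x m) := Function.update_self _ _ _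

theorem reflectSite_apply_of_ne {i m : Fin d} (h : i ≠ m) (c : Coord L) (x : Site d L) :
    reflectSite m c x i = x i := Function.update_of_ne h _ _

theorem shift_apply_self (m : Fin d) (x : Site d L) : shift m x m = (x m).next :=
  Function.update_self _ _ _

theorem shift_apply_of_ne {i m : Fin d} (h : m ≠ i) (x : Site d L) : shift i x m = x m :=
  Function.update_of_ne h _ _

theorem shift_reflectSite_of_ne {i m : Fin d} (h : i ≠ m) (c : Coord L) (x : Site d L) :
    shift i (reflectSite m c x) = reflectSite m c (shift i x) := by
  rw [shift, reflectSite_apply_of_ne h, reflectSite, reflectSite, shift_apply_of_ne h.symm, shift,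
    Function.update_comm h]

theorem shift_reflectSite_shift (m : Fin d) (c : Coord L) (x : Site d L) :
    shift m (reflectSite m c (shift m x)) = reflectSite m c x := by
  rw [shift, reflectSite_apply_self, shift_apply_self, Coord.next_reflect_next]
  simp [reflectSite, shift]

theorem reflectSite_eq_shift {m : Fin d} {c : Coord L} {x : Site d L}
    (h : c.rel (x m) = 0 ∨ c.rel (x m) = L) : reflectSite m c x = shift m x := by
  rw [reflectSite, shift, Coord.reflect_eq_next h]

/-- The bonds of the lattice `Λ`, labelled by the first endpoint and the direction, with the
parameters of the Hamiltonian. -/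
def latticeSystem (d L : ℕ) (κ g B : ℝ) : BondSystem (Site d L) (Site d L × Fin d) where
  src b := b.1
  tgt b := shift b.2 b.1
  amp b := κ * ((b.1 b.2).boundarySign * siteSign {j | j < b.2} b.1)
  field x := B * siteSign Finset.univ x
  coupling := g
  onsite := d * g / 2

theorem hamiltonian_eq_energy (κ g B : ℝ) (h : Fin d → Site d L → ℝ) :
    hamiltonian d L κ g B h = (latticeSystem d L κ g B).energy
      (fun x σ => annihilate (Fintype.equivFin (Mode d L)) (x, σ))
      (fun b => siteSign Finset.univ b.1 * h b.2 b.1) := by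
  have hp : ∀ x : Site d L, parity x = (siteSign Finset.univ x : ℂ) := fun x =>
    (coe_siteSign _ x).symm
  have hhop : hop d L κ = ∑ x : Site d L, ∑ i : Fin d,
      (Complex.I * ((latticeSystem d L κ g B).amp (x, i) : ℂ)) • hopBond x (shift i x) := by
    rw [hop, Finset.sum_comm]
    refine Finset.sum_congr rfl fun i _ => ?_
    rw [hopDir, Finset.sum_filter, Finset.sum_filter, Finset.smul_sum, Finset.smul_sum,
      ← Finset.sum_sub_distrib]
    refine Finset.sum_congr rfl fun x _ => ?_
    have hs : hopSign i x = (siteSign {j | j < i} x : ℂ) := (coe_siteSign _ x).symm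
    by_cases hx : (x i : ℤ) = L
    · simp only [latticeSystem, Coord.boundarySign, hx, hs, ne_eq, not_true_eq_false, if_true,
        if_false, smul_zero, zero_sub, smul_smul, ← neg_smul]
      congr 1
      push_cast; ring
    · simp only [latticeSystem, Coord.boundarySign, hx, hs, ne_eq, not_false_eq_true, if_true,
        if_false, smul_zero, sub_zero, smul_smul]
      congr 1
      push_cast; ring
  rw [hamiltonian, hhop, interaction, orderParameter, BondSystem.energy, Fintype.sum_prod_type]
  have hbond : ∀ (x : Site d L) (i : Fin d), (latticeSystem d L κ g B).bondTerm
      (fun x σ => annihilate (Fintype.equivFin (Mode d L)) (x, σ))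
      (siteSign Finset.univ x * h i x) (x, i) =
      (Complex.I * ((latticeSystem d L κ g B).amp (x, i) : ℂ)) • hopBond x (shift i x) +
        (((g / 4 : ℝ) : ℂ) • (Γ₁ x + Γ₁ (shift i x) +
          (parity x * (h i x : ℂ)) • (1 : Op d L)) ^ 2 -
        ((g / 4 : ℝ) : ℂ) • (Γ₂ x - Γ₂ (shift i x)) ^ 2) := by
    intro x i
    rw [← smul_sub, hp, ← Complex.ofReal_mul]
    rfl
  have hsite : ∀ x : Site d L, (latticeSystem d L κ g B).siteTerm
      (fun x σ => annihilate (Fintype.equivFin (Mode d L)) (x, σ)) x =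
      -(((d * g / 2 : ℝ) : ℂ) • (Γ₁ x ^ 2 - Γ₂ x ^ 2)) - (B : ℂ) • parity x • Γ₂ x := by
    intro x
    rw [hp, smul_smul, ← Complex.ofReal_mul]
    rfl
  simp only [hbond, hsite, Finset.sum_add_distrib, Finset.sum_sub_distrib, Finset.sum_neg_distrib,
    Finset.smul_sum, smul_sub]
  abel

/-- The mirror image of a bond; a bond in the direction of the reflection changes its
orientation. -/
def reflectBond (m : Fin d) (c : Coord L) (b : Site d L × Fin d) : Site d L × Fin d :=
  if b.2 = m then (reflectSite m c (shift m b.1), m) else (reflectSite m c b.1, b.2)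

/-- The signs of the particle-hole transformation for the reflection between `c` and `c + 1` in the
direction `m`. -/
def reflectSign (κ : ℝ) (m : Fin d) (c : Coord L) (x : Site d L) : ℝ :=
  (if 0 ≤ κ then 1 else -1) *
    (siteSign {j | j < m} x * (c.windSign (x m) * c.windSign (c.reflect (x m))))

theorem reflectSign_mul_self (κ : ℝ) (m : Fin d) (c : Coord L) (x : Site d L) :
    reflectSign κ m c x * reflectSign κ m c x = 1 := by
  have h1 := siteSign_mul_self {j | j < m} x
  have h2 := c.windSign_mul_self (x m)
  have h3 := c.windSign_mul_self (c.reflect (x m))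
  have h4 : (if 0 ≤ κ then (1 : ℝ) else -1) * (if 0 ≤ κ then 1 else -1) = 1 := by
    split_ifs <;> norm_num
  rw [reflectSign, mul_mul_mul_comm, mul_mul_mul_comm (siteSign _ _),
    mul_mul_mul_comm (c.windSign _), h1, h2, h3, h4]
  norm_num

theorem reflectSign_reflectSite (κ : ℝ) (m : Fin d) (c : Coord L) (x : Site d L) :
    reflectSign κ m c (reflectSite m c x) = reflectSign κ m c x := by
  rw [reflectSign, reflectSign, siteSign_reflectSite_of_notMem (by simp), reflectSite_apply_self,
    Coord.reflect_reflect, mul_comm (c.windSign _)]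

/-- The reflection of the lattice at the plane between `c` and `c + 1` in the direction `m` and
the opposite plane. -/
def latticeReflection (κ g B : ℝ) (hL : 1 ≤ L) (m : Fin d) (c : Coord L) :
    (latticeSystem d L κ g B).Reflection where
  left x := c.rel (x m) ≤ 0
  refl := reflectSite m c
  reflBond := reflectBond m c
  sign := reflectSign κ m c
  refl_refl := reflectSite_reflectSite m c
  left_refl x := by
    rw [reflectSite_apply_self, Coord.rel_reflect]
    omega
  reflBond_reflBond b := by
    obtain ⟨x, i⟩ := b
    by_cases h : i = m
    · subst h
      simp [reflectBond, shift_reflectSite_shift, reflectSite_reflectSite]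
    · simp [reflectBond, h, reflectSite_reflectSite]
  sign_mul_self := reflectSign_mul_self κ m c
  field_refl x := by
    simp only [latticeSystem, siteSign_reflectSite_of_mem (Finset.mem_univ m), mul_neg]
  bond b := by
    obtain ⟨x, i⟩ := b
    rw [reflectSign_reflectSite, reflectSign_reflectSite]
    by_cases h : i = m
    · subst h
      right
      simp only [latticeSystem, reflectBond, if_true, shift_reflectSite_shift, true_and]
      intro hside
      rw [shift_apply_self, Coord.rel_next] at hside
      have hmem := c.rel_mem (x i)
      have hne : c.rel (x i) ≠ L := by
        intro h
        rw [if_pos h] at hside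
        omega
      rw [if_neg hne] at hside
      have hne' : c.rel (c.reflect (x i).next) ≠ L := by
        rw [Coord.rel_reflect, Coord.rel_next, if_neg hne]
        omega
      rw [reflectSite_apply_self, shift_apply_self, Coord.boundarySign_of_ne hne,
        Coord.boundarySign_of_ne hne', Coord.next_reflect_next,
        siteSign_reflectSite_of_notMem (by simp), siteSign_shift_of_notMem (by simp), reflectSign,
        reflectSign, siteSign_shift_of_notMem (by simp), shift_apply_self]
      have h1 := siteSign_mul_self {j | j < i} x
      have h2 := c.windSign_mul_self (c.reflect (x i))
      have h3 := c.windSign_mul_self (c.reflect (x i).next)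
      have h4 : (if 0 ≤ κ then (1 : ℝ) else -1) * (if 0 ≤ κ then 1 else -1) = 1 := by
        split_ifs <;> norm_num
      generalize (if 0 ≤ κ then (1 : ℝ) else -1) = s at *
      generalize c.windSign (c.reflect (x i)) = p at *
      generalize c.windSign (c.reflect (x i).next) = q at *
      generalize siteSign {j | j < i} x = t at *
      calc _ = κ * (c.windSign (x i) * c.windSign (x i).next * t) *
            ((s * s) * (t * t) * (p * p) * (q * q)) := by ring
        _ = _ := by rw [h1, h2, h3, h4]; ring
    · left
      simp only [latticeSystem, reflectBond, if_neg h, shift_reflectSite_of_ne h, true_and]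
      have h2 := reflectSign_mul_self κ m c x
      have key : siteSign {j | j < i} (reflectSite m c x) * reflectSign κ m c (shift i x) =
          -(siteSign {j | j < i} x * reflectSign κ m c x) := by
        rw [reflectSign, reflectSign, shift_apply_of_ne (Ne.symm h)]
        rcases lt_or_gt_of_ne h with hlt | hlt
        · rw [siteSign_reflectSite_of_notMem (by simpa using hlt.le),
            siteSign_shift_of_mem (by simpa using hlt)]
          ring
        · rw [siteSign_reflectSite_of_mem (by simpa using hlt),
            siteSign_shift_of_notMem (by simpa using hlt.le)]
          ring
      rw [reflectSite_apply_of_ne h]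
      linear_combination κ * (x i).boundarySign * reflectSign κ m c x * key -
        κ * (x i).boundarySign * siteSign {j | j < i} x * h2
  crossing_left b hs ht := by
    obtain ⟨x, i⟩ := b
    simp only [latticeSystem] at hs ht ⊢
    have hi : i = m := by
      by_contra h
      rw [shift_apply_of_ne (Ne.symm h)] at ht
      exact ht hs
    subst hi
    have hmem := c.rel_mem (x i)
    have hrel : c.rel (x i) = 0 := by
      rw [shift_apply_self, Coord.rel_next] at ht
      split_ifs at ht <;> omega
    have hrefl := reflectSite_eq_shift (Or.inl hrel)
    refine ⟨hrefl.symm, ?_⟩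
    rw [← hrefl, reflectSign_reflectSite, reflectSign, Coord.reflect_eq_next (Or.inl hrel),
      ← Coord.boundarySign_of_ne (by omega)]
    have h1 := siteSign_mul_self {j | j < i} x
    have h2 : (x i).boundarySign * (x i).boundarySign = 1 := by
      rw [Coord.boundarySign]; split_ifs <;> norm_num
    have h3 : 0 ≤ κ * (if 0 ≤ κ then 1 else -1) := by
      split_ifs <;> linarith
    calc (0 : ℝ) ≤ κ * (if 0 ≤ κ then 1 else -1) := h3
      _ = κ * (if 0 ≤ κ then 1 else -1) * ((siteSign {j | j < i} x * siteSign {j | j < i} x) *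
          ((x i).boundarySign * (x i).boundarySign)) := by rw [h1, h2]; ring
      _ = _ := by ring
  crossing_right b hs ht := by
    obtain ⟨x, i⟩ := b
    simp only [latticeSystem] at hs ht ⊢
    have hi : i = m := by
      by_contra h
      rw [shift_apply_of_ne (Ne.symm h)] at ht
      exact hs ht
    subst hi
    have hmem := c.rel_mem (x i)
    have hrel : c.rel (x i) = L := by
      by_contra hne
      rw [shift_apply_self, Coord.rel_next, if_neg hne] at ht
      omega
    have hrefl := reflectSite_eq_shift (Or.inr hrel)
    refine ⟨hrefl.symm, ?_⟩
    rw [reflectSign, Coord.reflect_eq_next (Or.inr hrel),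
      ← neg_neg (c.windSign _ * c.windSign _), ← Coord.boundarySign_of_eq hrel]
    have h1 := siteSign_mul_self {j | j < i} x
    have h2 : (x i).boundarySign * (x i).boundarySign = 1 := by
      rw [Coord.boundarySign]; split_ifs <;> norm_num
    have h3 : 0 ≤ κ * (if 0 ≤ κ then 1 else -1) := by
      split_ifs <;> linarith
    calc _ = -(κ * (if 0 ≤ κ then 1 else -1)) *
          ((siteSign {j | j < i} x * siteSign {j | j < i} x) *
          ((x i).boundarySign * (x i).boundarySign)) := by ring
      _ = -(κ * (if 0 ≤ κ then 1 else -1)) := by rw [h1, h2]; ring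
      _ ≤ 0 := neg_nonpos.2 h3

theorem latticeReflection_crossing (κ g B : ℝ) (hL : 1 ≤ L) (x : Site d L) (m : Fin d) :
    ¬ ((latticeReflection κ g B hL m (x m)).left x ↔
      (latticeReflection κ g B hL m (x m)).left (shift m x)) := by
  have h0 : (x m).rel (x m) = 0 := by
    rw [Coord.rel]
    split_ifs <;> omega
  simp only [latticeReflection, shift_apply_self, Coord.rel_next, h0]
  rw [if_neg (by omega)]
  omega

end Lattice

end

end BCSLattice

theorem theorem4p3 (d L : ℕ) (hd : 1 ≤ d) (hL : 1 ≤ L) (κ g B β : ℝ) (hg : 0 < g) (hβ : 0 ≤ β)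
    (h : Fin d → BCSLattice.Site d L → ℝ) :
    Matrix.trace (NormedSpace.exp (-(β : ℂ) • BCSLattice.hamiltonian d L κ g B h)) ≤
      Matrix.trace (NormedSpace.exp (-(β : ℂ) • BCSLattice.hamiltonian d L κ g B 0)) := by
  open BCSLattice in
  have key := (latticeSystem d L κ g B).norm_partitionFunction_le
    (Fintype.equivFin (Mode d L)) hg.le hβ
    (fun b => ⟨latticeReflection κ g B hL b.2 (b.1 b.2),
      latticeReflection_crossing κ g B hL b.1 b.2⟩)
    (fun b => siteSign Finset.univ b.1 * h b.2 b.1)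
  have h0 : (fun b : BCSLattice.Site d L × Fin d => BCSLattice.siteSign Finset.univ b.1 *
      (0 : Fin d → BCSLattice.Site d L → ℝ) b.2 b.1) = 0 := by
    funext b; simp
  rw [BCSLattice.hamiltonian_eq_energy, BCSLattice.hamiltonian_eq_energy, h0]
  -- Both traces are nonnegative, so that they are equal to their norms.
  have hn := BCSLattice.BondSystem.partitionFunction_nonneg (BCSLattice.latticeSystem d L κ g B)
    (fun x σ => BCSLattice.annihilate (Fintype.equivFin (BCSLattice.Mode d L)) (x, σ)) β
  have e := fun k => Complex.eq_coe_norm_of_nonneg (hn k)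
  change BCSLattice.BondSystem.partitionFunction _ _ β _ ≤
    BCSLattice.BondSystem.partitionFunction _ _ β _
  rw [e, e 0]
  exact_mod_cast key
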